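/- Fix an integer $n\ge 2$ and let $R_n$ be the wedge of $n$ circles. **Definitions.** A *core graph of rank $n$* is a finite connected CW complex of dimension at most $1$ with no vertex of valence $1$ and with $1-|V|+|E|=n$. Its *natural vertices* are the vertices of valence $\ne 2$, and its *natural edges* are the closures of the components of the complement of the set of natural vertices. A *natural subgraph* $H\subset G$ is a union of natural edges (in particular it has no isolated points); its *graph complement* is $G\setminus H=\overline{G-H}$, and $H$ is *concrete* if $G\setminus H$ is a forest, i.e. contains no subspace homeomorphic to a circle. A *rank $n$ marked graph* is a core graph $G$ of rank $n$ together with a homotopy equivalence $\rho\colon R_n\to G$. Given rank $n$ marked graphs $(G,\rho)$, $(G',\rho')$, a *forest collapse* $q\colon G\to G'$ is a continuous map such that: (1) $q$ is a homotopy equivalence; (2) $q\circ\rho$ is homotopic to $\rho'$; (3) there is a concrete natural subgraph $H\subset G$, with complementary forest $K=G\setminus H$, such that $q$ is a quotient map and for each $x\in G'$ the set $q^{-1}(x)$ is either a single point of $G-K$ or a connected component of $K$. We then say that $(H,K)$ *witnesses* that $q$ is a forest collapse. **Theorem.** Let $G,G'$ be rank $n$ marked graphs. (a) If $q_1,q_2\colon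 G\to G'$ are forest collapses, then there is a homeomorphism $h\colon G\to G$ isotopic to the identity such that $q_2=q_1\circ h$. (b) If $(H_1,K_1)$ and $(H_2,K_2)$ witness that maps $q_1,q_2\colon G\to G'$, respectively, are forest collapses, then $H_1=H_2$ and $K_1=K_2$; moreover $q_1(e)=q_2(e)$ for each natural edge $e\subset H_1$. (c) If $(H,K)$ witnesses that $q\colon G\to G'$ is a forest collapse, then $e\mapsto q(e)$ is a bijection from the set of natural edges of $G$ contained in $H$ to the set of natural edges of $G'$. Consequently, writing $\Delta(E)=\{\ell\colon E\to[0,\infty) : \sum_{e\in E}\ell(e)=1\}$ and letting $\mathcal E G$, $\mathcal E G'$ be the sets of natural edges, if there exists a forest collapse $G\to G'$ then there is a unique map $r\colon\Delta(\mathcal E G')\to\Delta(\mathcal E G)$ such that for every forest collapse $q\colon G\to G'$ and every pair $(H,K)$ witnessing it, every $\ell \in \Delta(\mathcal E G')$ and every $e \in \mathcal E G$, one has $r(\ell)(e)=\ell(q(e))$ if $e\subset H$ and $r(\ell)(e)=0$ otherwise. That is, the face map is well-defined, independently of the choice of $q$. -/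

import Mathlib

open Set Topology Topology.CWComplex

universe u v

/-- A continuous map is a homotopy equivalence if it underlies a homotopy equivalence. -/
def IsHomotopyEquivMap {X : Type u} {Y : Type v} [TopologicalSpace X] [TopologicalSpace Y]
    (f : C(X, Y)) : Prop :=
  ∃ E : ContinuousMap.HomotopyEquiv X Y, E.toFun = f

/-- The base rose `R_n`, i.e. the wedge of `n` circles, realized inside the `n`-torus as the set of
points with at most one coordinate different from the base point `1` of the circle. -/
def BaseRose (n : ℕ) : Type :=
  {z : Fin n → Circle // ∀ i j, z i ≠ 1 → z j ≠ 1 → i = j}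

instance (n : ℕ) : TopologicalSpace (BaseRose n) :=
  inferInstanceAs (TopologicalSpace {z : Fin n → Circle // ∀ i j, z i ≠ 1 → z j ≠ 1 → i = j})

section Graphs

variable (X : Type u) [TopologicalSpace X] [CWComplex (univ : Set X)]

/-- The valence of a vertex: the number of ends of edges attached to it (the characteristic map
of an edge is defined on `[-1, 1]`, and a loop edge counts twice). -/
noncomputable def valence (w : cell (univ : Set X) 0) : ℕ :=
  Nat.card {e : cell (univ : Set X) 1 // map 1 e (-1) = map 0 w ![]} +
    Nat.card {e : cell (univ : Set X) 1 // map 1 e 1 = map 0 w ![]}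

/-- `X` is a core graph of rank `n`: a finite connected CW complex of dimension at most one, without
vertices of valence one, with `1 - |V| + |E| = n`. -/
structure IsCoreGraph (n : ℕ) : Prop where
  connected : ConnectedSpace X
  finite : CWComplex.Finite (univ : Set X)
  isEmpty_cell : ∀ m, 2 ≤ m → IsEmpty (cell (univ : Set X) m)
  valence_ne_one : ∀ w : cell (univ : Set X) 0, valence X w ≠ 1
  rank_eq : 1 + Nat.card (cell (univ : Set X) 1) = n + Nat.card (cell (univ : Set X) 0)

/-- The natural vertices: the vertices of valence different from two. -/
def naturalVertices : Set X :=
  {x | ∃ w : cell (univ : Set X) 0, valence X w ≠ 2 ∧ x = map 0 w ![]}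

/-- The natural edges: the closures of the connected components of the complement of the set of
natural vertices. -/
def naturalEdges : Set (Set X) :=
  {e | ∃ x ∈ (naturalVertices X)ᶜ, e = closure (connectedComponentIn (naturalVertices X)ᶜ x)}

variable {X}

/-- A natural subgraph is a union of natural edges. -/
def IsNaturalSubgraph (H : Set X) : Prop :=
  ∃ S ⊆ naturalEdges X, H = ⋃₀ S

end Graphs

/-- A subgraph is a forest if it contains no subspace homeomorphic to a circle. -/
def IsForest {X : Type u} [TopologicalSpace X] (K : Set X) : Prop :=
  ¬ ∃ c : Circle → X, IsEmbedding c ∧ range c ⊆ K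

/-- The graph complement `G \ H`: the closure of the set complement. -/
def graphCompl {X : Type u} [TopologicalSpace X] (H : Set X) : Set X :=
  closure Hᶜ

/-- A natural subgraph is concrete if its graph complement is a forest. -/
def IsConcrete {X : Type u} [TopologicalSpace X] [CWComplex (univ : Set X)] (H : Set X) : Prop :=
  IsNaturalSubgraph H ∧ IsForest (graphCompl H)

/-- A rank `n` marked graph: a (Hausdorff) core graph of rank `n` together with a homotopy
equivalence from the base rose. -/
structure MarkedGraph (n : ℕ) where
  carrier : Type u
  [top : TopologicalSpace carrier]
  [t2 : T2Space carrier]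
  [cw : CWComplex (univ : Set carrier)]
  isCore : IsCoreGraph carrier n
  marking : C(BaseRose n, carrier)
  isHomotopyEquiv_marking : IsHomotopyEquivMap marking

attribute [instance] MarkedGraph.top MarkedGraph.t2 MarkedGraph.cw

/-- `q` is a forest collapse from `G` to `G'`, as witnessed by the concrete natural subgraph `H` and
the complementary forest `K`. -/
structure IsForestCollapseWith {n : ℕ} (G : MarkedGraph.{u} n) (G' : MarkedGraph.{v} n)
    (q : C(G.carrier, G'.carrier)) (H K : Set G.carrier) : Prop where
  isHomotopyEquiv : IsHomotopyEquivMap q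
  preservesMarking : (q.comp G.marking).Homotopic G'.marking
  concrete : IsConcrete H
  compl_eq : K = graphCompl H
  isQuotientMap : IsQuotientMap q
  fiber : ∀ y : G'.carrier, (∃ x ∈ Kᶜ, q ⁻¹' {y} = {x}) ∨
    (∃ x ∈ K, q ⁻¹' {y} = connectedComponentIn K x)

/-- `q` is a forest collapse from `G` to `G'`. -/
def IsForestCollapse {n : ℕ} (G : MarkedGraph.{u} n) (G' : MarkedGraph.{v} n)
    (q : C(G.carrier, G'.carrier)) : Prop :=
  ∃ H K : Set G.carrier, IsForestCollapseWith G G' q H K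

/-- The homeomorphism `h` is isotopic to the identity. -/
def IsIsotopicToId {X : Type u} [TopologicalSpace X] (h : X ≃ₜ X) : Prop :=
  ∃ F : C(unitInterval × X, X), (∀ x, F (0, x) = x) ∧ (∀ x, F (1, x) = h x) ∧
    ∀ t, IsHomeomorph (fun x => F (t, x))

/-- The natural edges contained in the subgraph `H`. -/
def edgesIn {X : Type u} [TopologicalSpace X] [CWComplex (univ : Set X)] (H : Set X) :
    Set (Set X) :=
  {e | e ∈ naturalEdges X ∧ e ⊆ H}

/-- The simplex of normalized length structures on the set of natural edges. -/
def lengthSimplex (X : Type u) [TopologicalSpace X] [CWComplex (univ : Set X)] :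
    Set (naturalEdges X → ℝ) :=
  {l | (∀ e, 0 ≤ l e) ∧ ∑ᶠ e, l e = 1}

/-- `r` is the face map induced by the collapse map `q` with uncollapsed subgraph `H`: the edge `q e`
transfers its length to `e` for every natural edge `e` of `H`, and all other edges get length `0`. -/
def IsFaceMap {X : Type u} {X' : Type v} [TopologicalSpace X] [TopologicalSpace X']
    [CWComplex (univ : Set X)] [CWComplex (univ : Set X')] (q : X → X') (H : Set X)
    (r : lengthSimplex X' → lengthSimplex X) : Prop :=
  ∀ (l : lengthSimplex X') (e : naturalEdges X),
    (∀ e' : naturalEdges X', (e : Set X) ⊆ H → (e' : Set X') = q '' (e : Set X) →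
      (r l).1 e = l.1 e') ∧
    (¬ (e : Set X) ⊆ H → (r l).1 e = 0)

-- A vertex of valence at least three is visible in the topology alone, and for rank at least two
-- the natural vertices are exactly such points. After the vertices of valence two have been merged
-- away (`exists_merged`), a core graph becomes an `ArcDecomp` with all valences at least three
-- (`IsCoreGraph.exists_natural_decomp`), and any two such decompositions of one space have the same
-- vertices and open arcs.
--
-- A collapse pushes the decomposition of the source to one of the target. Arcs collapsed by a
-- homotopy equivalence number fewer than the vertices they span (`card_lt_of_collapsed`, a count of
-- cochains mod 2). With B the collapsed arcs inside a fibre and W its vertices, at least 3|W| -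
-- 2|B| ≥ |W| + 2 ends leave the fibre, so the pushed decomposition again has valences at least
-- three and must be the natural one. This matches the surviving edges with the natural edges of the
-- target, which is (c).
--
-- For (b), two collapses compatible with the markings are homotopic. Label the arcs of the target
-- by free generators and use monodromy in the resulting covering: each source arc reads a letter,
-- an inverse letter or the empty word, and the homotopy conjugates the two readings by a function h
-- on the vertices (`exists_conj_of_homotopic`). Where h is nontrivial and of maximal length, moving
-- along a dart lengthens it unless the dart reads nothing under both maps or cancels the first or
-- last letter of h. At most two darts can cancel, while at least three leave the forest of doubly
-- collapsed arcs on the vertices with this value of h. Hence h = 1 and the readings agree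
-- (`letterWord_eq_of_conj`).
--
-- Equal readings mean the same collapsed forest, the same target edges and the same orientations.
-- The two maps then differ on each surviving arc only by a monotone reparametrization, and
-- straight-line interpolation of these gives the isotopy of (a). The face map is transport of
-- lengths along the bijection of (c), independent of choices by (b).

universe w

/-! ### Topology of arc decompositions -/

/-- A decomposition of a space into finitely many vertices and open arcs. -/
structure ArcDecomp (X : Type u) [TopologicalSpace X] (E : Type v) where
  vertices : Finset X
  arc : E → ℝ → X
  continuous_arc : ∀ e, Continuous (arc e)
  zero_mem : ∀ e, arc e 0 ∈ vertices
  one_mem : ∀ e, arc e 1 ∈ vertices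
  notMem : ∀ e, ∀ t ∈ Ioo (0 : ℝ) 1, arc e t ∉ vertices
  inj : ∀ e e' t t', t ∈ Ioo (0 : ℝ) 1 → t' ∈ Ioo (0 : ℝ) 1 → arc e t = arc e' t' →
    e = e' ∧ t = t'
  cover : ∀ x, x ∈ vertices ∨ ∃ e, ∃ t ∈ Ioo (0 : ℝ) 1, arc e t = x

namespace ArcDecomp

variable {X : Type u} [TopologicalSpace X] {E : Type v} (S : ArcDecomp X E)

open Classical in
/-- The number of ends of arcs at `x`. -/
noncomputable def deg [Fintype E] (x : X) : ℕ :=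
  ∑ e, ((if S.arc e 0 = x then 1 else 0) + (if S.arc e 1 = x then 1 else 0))

/-- The open arc with index `e`. -/
def openArc (e : E) : Set X := S.arc e '' Ioo 0 1

/-- The closed arc with index `e`. -/
def closedArc (e : E) : Set X := S.arc e '' Icc 0 1

lemma openArc_subset_closedArc (e : E) : S.openArc e ⊆ S.closedArc e :=
  image_mono Ioo_subset_Icc_self

lemma mem_Icc_cases {t : ℝ} (ht : t ∈ Icc (0 : ℝ) 1) : t = 0 ∨ t = 1 ∨ t ∈ Ioo (0 : ℝ) 1 := by
  rcases ht.1.eq_or_lt with h | h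
  · exact .inl h.symm
  rcases ht.2.eq_or_lt with h' | h'
  · exact .inr (.inl h')
  · exact .inr (.inr ⟨h, h'⟩)

lemma mem_closedArc {e : E} {x : X} :
    x ∈ S.closedArc e ↔ x = S.arc e 0 ∨ x = S.arc e 1 ∨ x ∈ S.openArc e := by
  constructor
  · rintro ⟨t, ht, rfl⟩
    rcases mem_Icc_cases ht with rfl | rfl | h
    exacts [.inl rfl, .inr (.inl rfl), .inr (.inr ⟨t, h, rfl⟩)]
  · rintro (rfl | rfl | h)
    exacts [⟨0, by simp, rfl⟩, ⟨1, by simp, rfl⟩, S.openArc_subset_closedArc e h]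

lemma notMem_of_mem_openArc {e : E} {x : X} (h : x ∈ S.openArc e) : x ∉ S.vertices := by
  obtain ⟨t, ht, rfl⟩ := h
  exact S.notMem e t ht

lemma eq_of_mem_openArc {e e' : E} {x : X} (h : x ∈ S.openArc e) (h' : x ∈ S.openArc e') :
    e = e' := by
  obtain ⟨t, ht, rfl⟩ := h
  obtain ⟨t', ht', h⟩ := h'
  exact (S.inj _ _ _ _ ht ht' h.symm).1

lemma mem_vertices_of_mem_closedArc {e : E} {x : X} (h : x ∈ S.closedArc e)
    (h' : x ∉ S.openArc e) : x ∈ S.vertices := by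
  rcases S.mem_closedArc.1 h with rfl | rfl | h
  exacts [S.zero_mem e, S.one_mem e, absurd h h']

lemma eq_of_mem_openArc_of_mem_closedArc {e e' : E} {x : X} (h : x ∈ S.openArc e)
    (h' : x ∈ S.closedArc e') : e = e' := by
  by_cases hx : x ∈ S.openArc e'
  · exact S.eq_of_mem_openArc h hx
  · exact absurd (S.mem_vertices_of_mem_closedArc h' hx) (S.notMem_of_mem_openArc h)

lemma half_mem : (1 / 2 : ℝ) ∈ Ioo (0 : ℝ) 1 := by norm_num

lemma arc_half_mem_openArc (e : E) : S.arc e (1 / 2) ∈ S.openArc e := ⟨_, half_mem, rfl⟩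

lemma closedArc_injective : Function.Injective S.closedArc := fun e _ h =>
  S.eq_of_mem_openArc_of_mem_closedArc (S.arc_half_mem_openArc e)
    (h ▸ S.openArc_subset_closedArc e (S.arc_half_mem_openArc e))

lemma isCompact_closedArc (e : E) : IsCompact (S.closedArc e) :=
  isCompact_Icc.image (S.continuous_arc e)

lemma isClosed_closedArc [T2Space X] (e : E) : IsClosed (S.closedArc e) :=
  (S.isCompact_closedArc e).isClosed

lemma isClosed_iUnion_closedArc [T2Space X] [Finite E] (A : Set E) :
    IsClosed (⋃ e ∈ A, S.closedArc e) :=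
  A.toFinite.isClosed_biUnion fun e _ => S.isClosed_closedArc e

lemma isClosed_finset [T2Space X] (W : Finset X) : IsClosed (W : Set X) :=
  W.finite_toSet.isClosed

/-- With finitely many arcs, the complement is a finite union of compact sets: the vertices, the
other closed arcs, and the image of the rest of the closed interval. This makes the parametrization
of an open arc a homeomorphism onto an open set. -/
lemma isOpen_image_arc [T2Space X] [Finite E] (e : E) {A : Set ℝ} (hA : IsOpen A)
    (hA' : A ⊆ Ioo 0 1) : IsOpen (S.arc e '' A) := by
  have h : (S.arc e '' A)ᶜ =
      (S.vertices : Set X) ∪ (⋃ e' ∈ ({e}ᶜ : Set E), S.closedArc e') ∪ S.arc e '' (Icc 0 1 \ A) := by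
    ext x
    simp only [mem_compl_iff, mem_union, Finset.mem_coe, mem_iUnion, mem_singleton_iff, exists_prop]
    constructor
    · intro hx
      rcases S.cover x with h | ⟨e', t, ht, rfl⟩
      · exact .inl (.inl h)
      by_cases he : e' = e
      · subst he
        exact .inr ⟨t, ⟨Ioo_subset_Icc_self ht, fun h => hx ⟨t, h, rfl⟩⟩, rfl⟩
      · exact .inl (.inr ⟨e', he, S.openArc_subset_closedArc _ ⟨t, ht, rfl⟩⟩)
    · rintro hx ⟨t, ht, rfl⟩
      have ho : S.arc e t ∈ S.openArc e := ⟨t, hA' ht, rfl⟩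
      rcases hx with (h | ⟨e', he, h⟩) | ⟨t', ⟨ht', hA''⟩, h⟩
      · exact S.notMem_of_mem_openArc ho h
      · exact he (S.eq_of_mem_openArc_of_mem_closedArc ho h).symm
      · rcases mem_Icc_cases ht' with rfl | rfl | h'
        · exact S.notMem_of_mem_openArc ho (h ▸ S.zero_mem e)
        · exact S.notMem_of_mem_openArc ho (h ▸ S.one_mem e)
        · exact hA'' ((S.inj _ _ _ _ h' (hA' ht) h).2 ▸ ht)
  rw [← isClosed_compl_iff, h]
  exact ((isClosed_finset _).union (S.isClosed_iUnion_closedArc _)).union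
    (((isCompact_Icc.diff hA).image (S.continuous_arc e)).isClosed)

lemma isOpen_openArc [T2Space X] [Finite E] (e : E) : IsOpen (S.openArc e) :=
  S.isOpen_image_arc e isOpen_Ioo subset_rfl

lemma isPreconnected_openArc (e : E) : IsPreconnected (S.openArc e) :=
  isPreconnected_Ioo.image _ (S.continuous_arc e).continuousOn

lemma closure_openArc [T2Space X] (e : E) : closure (S.openArc e) = S.closedArc e := by
  apply subset_antisymm
  · exact closure_minimal (S.openArc_subset_closedArc e) (S.isClosed_closedArc e)
  · rw [closedArc, ← closure_Ioo (zero_ne_one' ℝ)]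
    exact image_closure_subset_closure_image (S.continuous_arc e)

lemma iUnion_closedArc_union_vertices : (⋃ e, S.closedArc e) ∪ S.vertices = univ := by
  refine eq_univ_of_forall fun x => ?_
  rcases S.cover x with h | ⟨e, t, ht, rfl⟩
  · exact .inr h
  · exact .inl (mem_iUnion.2 ⟨e, S.openArc_subset_closedArc e ⟨t, ht, rfl⟩⟩)

include S in
lemma compactSpace [Finite E] : CompactSpace X := by
  refine ⟨?_⟩
  rw [← S.iUnion_closedArc_union_vertices]
  exact (isCompact_iUnion S.isCompact_closedArc).union S.vertices.finite_toSet.isCompact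

/-- The inverse of an arc. -/
noncomputable def arcInv (e : E) : X → ℝ := Function.invFunOn (S.arc e) (Ioo 0 1)

lemma injOn_arc (e : E) : InjOn (S.arc e) (Ioo 0 1) := fun _ ht _ ht' h =>
  (S.inj _ _ _ _ ht ht' h).2

lemma arcInv_arc {e : E} {t : ℝ} (ht : t ∈ Ioo (0 : ℝ) 1) : S.arcInv e (S.arc e t) = t :=
  (S.injOn_arc e).leftInvOn_invFunOn ht

lemma arc_arcInv {e : E} {x : X} (hx : x ∈ S.openArc e) : S.arc e (S.arcInv e x) = x := by
  obtain ⟨t, ht, rfl⟩ := hx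
  rw [S.arcInv_arc ht]

lemma arcInv_mem {e : E} {x : X} (hx : x ∈ S.openArc e) : S.arcInv e x ∈ Ioo (0 : ℝ) 1 := by
  obtain ⟨t, ht, rfl⟩ := hx
  rwa [S.arcInv_arc ht]

lemma continuousOn_arcInv [T2Space X] [Finite E] (e : E) :
    ContinuousOn (S.arcInv e) (S.openArc e) := by
  refine IsOpenMap.continuousOn_image_of_leftInvOn (f := S.arc e) ?_ fun t ht => S.arcInv_arc ht
  intro A hA
  obtain ⟨B, hB, rfl⟩ := isOpen_induced_iff.1 hA
  rw [image_domRestrict]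
  exact S.isOpen_image_arc e (hB.inter isOpen_Ioo) inter_subset_right

/-- The open arcs are connected, open and pairwise disjoint, and they cover the complement of the
vertices. Hence the vertex set alone determines the open arcs. -/
lemma connectedComponentIn_compl_vertices [T2Space X] [Finite E] {e : E} {x : X}
    (hx : x ∈ S.openArc e) :
    connectedComponentIn (S.vertices : Set X)ᶜ x = S.openArc e := by
  have hsub : S.openArc e ⊆ (S.vertices : Set X)ᶜ := fun y hy => S.notMem_of_mem_openArc hy
  apply subset_antisymm
  · have hc := isPreconnected_connectedComponentIn (x := x) (F := (S.vertices : Set X)ᶜ)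
    have hxc : x ∈ connectedComponentIn (S.vertices : Set X)ᶜ x :=
      mem_connectedComponentIn (hsub hx)
    refine hc.subset_left_of_subset_union (S.isOpen_openArc e)
      (isOpen_biUnion (s := ({e}ᶜ : Set E)) fun e' _ => S.isOpen_openArc e') ?_ ?_ ⟨x, hxc, hx⟩
    · rw [disjoint_iUnion₂_right]
      intro e' he'
      rw [disjoint_left]
      exact fun y hy hy' => he' (S.eq_of_mem_openArc hy' hy)
    · intro y hy
      rcases S.cover y with h | ⟨e', t, ht, rfl⟩
      · exact absurd h (connectedComponentIn_subset _ _ hy)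
      by_cases he : e' = e
      · subst he; exact .inl ⟨t, ht, rfl⟩
      · exact .inr (mem_iUnion₂.2 ⟨e', he, t, ht, rfl⟩)
  · exact (S.isPreconnected_openArc e).subset_connectedComponentIn hx hsub

lemma naturalEdges_eq [T2Space X] [Finite E] [CWComplex (univ : Set X)]
    (h : naturalVertices X = S.vertices) : naturalEdges X = range S.closedArc := by
  ext c
  simp only [naturalEdges, h, mem_ofPred_eq, mem_range]
  constructor
  · rintro ⟨x, hx, rfl⟩
    rcases S.cover x with h | ⟨e, t, ht, rfl⟩
    · exact absurd h hx
    refine ⟨e, ?_⟩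
    rw [S.connectedComponentIn_compl_vertices ⟨t, ht, rfl⟩, S.closure_openArc]
  · rintro ⟨e, rfl⟩
    refine ⟨_, S.notMem e _ half_mem, ?_⟩
    rw [S.connectedComponentIn_compl_vertices (S.arc_half_mem_openArc e), S.closure_openArc]

/-- `W` with the arcs in `A`, and the remaining vertices with the remaining arcs, are complementary
finite unions of closed sets; connectedness makes the first everything. This serves to exclude
circle components and isolated vertices. -/
lemma eq_vertices_of_closed_under_arcs [T2Space X] [Finite E] [PreconnectedSpace X]
    {W : Finset X} (hW : W.Nonempty) (hWV : W ⊆ S.vertices) {A : Set E}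
    (hA : ∀ e ∈ A, S.arc e 0 ∈ W ∧ S.arc e 1 ∈ W)
    (hA' : ∀ e ∉ A, S.arc e 0 ∉ W ∧ S.arc e 1 ∉ W) : W = S.vertices ∧ A = univ := by
  set C : Set X := (W : Set X) ∪ ⋃ e ∈ A, S.closedArc e with hC
  have hCc : Cᶜ = ((S.vertices : Set X) \ W) ∪ ⋃ e ∈ Aᶜ, S.closedArc e := by
    ext x
    simp only [hC, mem_compl_iff, mem_union, Finset.mem_coe, mem_iUnion, exists_prop, mem_sdiff,
      not_or, not_exists, not_and]
    constructor
    · rintro ⟨h1, h2⟩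
      rcases S.cover x with h | ⟨e', t, ht, rfl⟩
      · exact .inl ⟨h, h1⟩
      · have := S.openArc_subset_closedArc e' ⟨t, ht, rfl⟩
        exact .inr ⟨e', fun h => h2 e' h this, this⟩
    · rintro (⟨h1, h2⟩ | ⟨e, he, hx⟩)
      · refine ⟨h2, fun e he hx => ?_⟩
        rcases S.mem_closedArc.1 hx with rfl | rfl | h
        exacts [h2 (hA e he).1, h2 (hA e he).2, S.notMem_of_mem_openArc h h1]
      · constructor
        · intro hxW
          rcases S.mem_closedArc.1 hx with rfl | rfl | h
          exacts [(hA' e he).1 hxW, (hA' e he).2 hxW, S.notMem_of_mem_openArc h (hWV hxW)]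
        · intro e' he' hx'
          by_cases ho : x ∈ S.openArc e'
          · exact he (S.eq_of_mem_openArc_of_mem_closedArc ho hx ▸ he')
          have hxW : x ∈ W := by
            rcases S.mem_closedArc.1 hx' with rfl | rfl | h
            exacts [(hA e' he').1, (hA e' he').2, absurd h ho]
          rcases S.mem_closedArc.1 hx with rfl | rfl | h
          exacts [(hA' e he).1 hxW, (hA' e he).2 hxW, S.notMem_of_mem_openArc h (hWV hxW)]
  have hcl : IsClopen C := by
    refine ⟨(isClosed_finset W).union (S.isClosed_iUnion_closedArc A), ?_⟩
    classical
    rw [← isClosed_compl_iff, hCc, show (S.vertices : Set X) \ W = ((S.vertices.filter (· ∉ W) : Finset X) : Set X) by ext; simp]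
    exact (isClosed_finset _).union (S.isClosed_iUnion_closedArc _)
  have hne : C.Nonempty := let ⟨w, hw⟩ := hW; ⟨w, .inl hw⟩
  have huniv : C = univ := (isClopen_iff.1 hcl).resolve_left hne.ne_empty
  have hemp : ∀ x, x ∉ ((S.vertices : Set X) \ W) ∪ ⋃ e ∈ Aᶜ, S.closedArc e := by
    intro x
    rw [← hCc, huniv]
    simp
  constructor
  · refine subset_antisymm hWV fun x hx => ?_
    by_contra h
    exact hemp x (.inl ⟨hx, h⟩)
  · refine eq_univ_of_forall fun e => ?_
    by_contra h
    exact hemp (S.arc e 0) (.inr (mem_iUnion₂.2 ⟨e, h, 0, by simp, rfl⟩))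

end ArcDecomp

/-! ### Reparametrization, and topological invariance of vertices of valence at least three -/

/-- A strictly increasing self-bijection of the open unit interval extends to an order
automorphism of the line. -/
lemma exists_orderIso_of_strictMonoOn_Ioo {f : ℝ → ℝ} (hf : StrictMonoOn f (Ioo 0 1))
    (himg : f '' Ioo 0 1 = Ioo 0 1) :
    ∃ τ : ℝ ≃o ℝ, τ 0 = 0 ∧ τ 1 = 1 ∧ ∀ t ∈ Ioo (0 : ℝ) 1, τ t = f t := by
  classical
  have hmem : ∀ t ∈ Ioo (0 : ℝ) 1, f t ∈ Ioo (0 : ℝ) 1 := fun t ht => himg ▸ mem_image_of_mem f ht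
  -- Since `f` preserves the open interval, the identity outside fits it monotonically, and no limit
  -- at the endpoints is needed.
  set g : ℝ → ℝ := fun t => if t ∈ Ioo (0 : ℝ) 1 then f t else t with hg
  have hg1 : ∀ t ∈ Ioo (0 : ℝ) 1, g t = f t := fun t ht => by simp only [hg, if_pos ht]
  have hg2 : ∀ t ∉ Ioo (0 : ℝ) 1, g t = t := fun t ht => by simp only [hg, if_neg ht]
  have hmono : StrictMono g := by
    intro s t hst
    by_cases hs : s ∈ Ioo (0 : ℝ) 1 <;> by_cases ht : t ∈ Ioo (0 : ℝ) 1
    · rw [hg1 s hs, hg1 t ht]; exact hf hs ht hst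
    · rw [hg1 s hs, hg2 t ht]
      have := hmem s hs
      simp only [mem_Ioo, not_and, not_lt] at ht hs this
      linarith [ht (hs.1.trans hst)]
    · rw [hg2 s hs, hg1 t ht]
      have := hmem t ht
      simp only [mem_Ioo, not_and, not_lt] at ht hs this
      by_contra! h
      linarith [hs (by linarith)]
    · rwa [hg2 s hs, hg2 t ht]
  have hsurj : Function.Surjective g := by
    intro y
    by_cases hy : y ∈ Ioo (0 : ℝ) 1
    · rw [← himg] at hy
      obtain ⟨t, ht, rfl⟩ := hy
      exact ⟨t, hg1 t ht⟩
    · exact ⟨y, hg2 y hy⟩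
  exact ⟨StrictMono.orderIsoOfSurjective g hmono hsurj, hg2 0 (by simp), hg2 1 (by simp), hg1⟩

namespace ArcDecomp

variable {X : Type u} [TopologicalSpace X] {E : Type v} (S : ArcDecomp X E)
  {E' : Type w} (T : ArcDecomp X E')

/-- Two arcs with the same image differ by a reparametrization, up to orientation. -/
lemma exists_reparam [T2Space X] [Finite E'] {e : E} {e' : E'}
    (h : S.openArc e = T.openArc e') : ∃ τ : ℝ ≃o ℝ, τ 0 = 0 ∧ τ 1 = 1 ∧
      ((∀ t ∈ Icc (0 : ℝ) 1, S.arc e t = T.arc e' (τ t)) ∨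
        ∀ t ∈ Icc (0 : ℝ) 1, S.arc e t = T.arc e' (1 - τ t)) := by
  set f : ℝ → ℝ := fun t => T.arcInv e' (S.arc e t) with hf
  have hmem : ∀ t ∈ Ioo (0 : ℝ) 1, S.arc e t ∈ T.openArc e' := fun t ht => h ▸ ⟨t, ht, rfl⟩
  have hfe : ∀ t ∈ Ioo (0 : ℝ) 1, T.arc e' (f t) = S.arc e t := fun t ht =>
    T.arc_arcInv (hmem t ht)
  have hcont : ContinuousOn f (Ioo 0 1) :=
    (T.continuousOn_arcInv e').comp (S.continuous_arc e).continuousOn hmem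
  have hinj : InjOn f (Ioo 0 1) := by
    intro s hs t ht hst
    apply S.injOn_arc e hs ht
    rw [← hfe s hs, ← hfe t ht, hst]
  have himg : f '' Ioo 0 1 = Ioo 0 1 := by
    apply subset_antisymm
    · rintro _ ⟨t, ht, rfl⟩
      exact T.arcInv_mem (hmem t ht)
    · intro s hs
      obtain ⟨t, ht, hts⟩ : T.arc e' s ∈ S.openArc e := h ▸ ⟨s, hs, rfl⟩
      exact ⟨t, ht, by rw [hf]; simp only [hts, T.arcInv_arc hs]⟩
  -- The formula holds on the open interval and passes to the endpoints by density.
  have hext : ∀ g : ℝ → ℝ, Continuous g → (∀ t ∈ Ioo (0 : ℝ) 1, g t = f t) →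
      ∀ t ∈ Icc (0 : ℝ) 1, S.arc e t = T.arc e' (g t) := by
    intro g hg hgf
    have : EqOn (S.arc e) (fun t => T.arc e' (g t)) (Ioo 0 1) := fun t ht => by
      simp only [hgf t ht, hfe t ht]
    have := this.closure (S.continuous_arc e) ((T.continuous_arc e').comp hg)
    rwa [closure_Ioo (zero_ne_one' ℝ)] at this
  -- A continuous injection of an interval is strictly monotone; the decreasing case is reflected by
  -- `1 - f`.
  rcases hcont.strictMonoOn_of_injOn_Ioo zero_lt_one hinj with hm | hm
  · obtain ⟨τ, h0, h1, hτ⟩ := exists_orderIso_of_strictMonoOn_Ioo hm himg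
    exact ⟨τ, h0, h1, .inl (hext τ τ.continuous hτ)⟩
  · have hm' : StrictMonoOn (fun t => 1 - f t) (Ioo 0 1) := fun s hs t ht hst =>
      sub_lt_sub_left (hm hs ht hst) 1
    have himg' : (fun t => 1 - f t) '' Ioo 0 1 = Ioo 0 1 := by
      rw [← image_image (fun x => 1 - x) f, himg]
      simp
    obtain ⟨τ, h0, h1, hτ⟩ := exists_orderIso_of_strictMonoOn_Ioo hm' himg'
    refine ⟨τ, h0, h1, .inr (hext (fun t => 1 - τ t) (continuous_const.sub τ.continuous) ?_)⟩
    intro t ht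
    rw [hτ t ht]
    ring

/-- The arc with index `d.1`, traversed backwards if `d.2` is true. -/
def dart (d : E × Bool) (t : ℝ) : X := S.arc d.1 (bif d.2 then 1 - t else t)

lemma continuous_dart (d : E × Bool) : Continuous (S.dart d) := by
  unfold dart
  refine (S.continuous_arc d.1).comp ?_
  cases d.2 <;> simp <;> fun_prop

lemma dart_mem {d : E × Bool} {t : ℝ} (ht : t ∈ Ioo (0 : ℝ) 1) : S.dart d t ∈ S.openArc d.1 := by
  obtain ⟨e, b⟩ := d
  cases b
  · exact ⟨t, ht, rfl⟩
  · exact ⟨1 - t, by simpa [and_comm] using ht, rfl⟩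

lemma dart_inj {d d' : E × Bool} {t t' : ℝ} (ht : t ∈ Ioo (0 : ℝ) (1 / 2))
    (ht' : t' ∈ Ioo (0 : ℝ) (1 / 2)) (h : S.dart d t = S.dart d' t') : d = d' := by
  obtain ⟨e, b⟩ := d
  obtain ⟨e', b'⟩ := d'
  simp only [mem_Ioo] at ht ht'
  have hI : ∀ (b : Bool) (t : ℝ), 0 < t ∧ t < 1 / 2 → (bif b then 1 - t else t) ∈ Ioo (0 : ℝ) 1 := by
    rintro (_ | _) t ht <;> simp <;> constructor <;> linarith
  obtain ⟨rfl, h'⟩ := S.inj _ _ _ _ (hI b t ht) (hI b' t' ht') h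
  cases b <;> cases b' <;> simp at h' ⊢ <;> linarith

open Classical in
lemma deg_eq_card [Fintype E] (x : X) :
    S.deg x = (Finset.univ.filter fun d : E × Bool => S.dart d 0 = x).card := by
  rw [Finset.card_filter, Fintype.sum_prod_type]
  refine Finset.sum_congr rfl fun e _ => ?_
  rw [Fintype.sum_bool]
  simp [dart, add_comm]

/-- Near its origin, a dart covers one of the sides of the origin in any open arc containing it. -/
lemma dart_covers_side [T2Space X] [Finite E'] {d : E × Bool} {e' : E'} {t₀ : ℝ}
    (hv : S.dart d 0 ∈ S.vertices) (ht₀ : t₀ ∈ Ioo (0 : ℝ) 1) (h : S.dart d 0 = T.arc e' t₀) :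
    ∃ b : Bool, ∃ δ > 0, ∀ s ∈ Ioo 0 δ, ∃ t ∈ Ioo (0 : ℝ) (1 / 2),
      S.dart d t = T.arc e' (bif b then t₀ + s else t₀ - s) := by
  have hO : IsOpen (S.dart d ⁻¹' T.openArc e') := (T.isOpen_openArc e').preimage (S.continuous_dart d)
  have h0 : (0 : ℝ) ∈ S.dart d ⁻¹' T.openArc e' := ⟨t₀, ht₀, h.symm⟩
  obtain ⟨r, hr, hball⟩ := Metric.isOpen_iff.1 hO 0 h0
  set ε := min (r / 2) (1 / 4) with hε
  have hε0 : 0 < ε := by positivity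
  have hε1 : ε ≤ 1 / 4 := min_le_right _ _
  have hsub : Icc 0 ε ⊆ S.dart d ⁻¹' T.openArc e' := by
    intro t ht
    apply hball
    rw [Metric.mem_ball, Real.dist_eq, sub_zero, abs_of_nonneg ht.1]
    linarith [ht.2, min_le_left (r / 2) (1 / 4 : ℝ)]
  set f : ℝ → ℝ := fun t => T.arcInv e' (S.dart d t) with hf
  have hfc : ContinuousOn f (Icc 0 ε) :=
    (T.continuousOn_arcInv e').comp (S.continuous_dart d).continuousOn hsub
  have hfe : ∀ t ∈ Icc 0 ε, T.arc e' (f t) = S.dart d t := fun t ht => T.arc_arcInv (hsub ht)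
  have hf0 : f 0 = t₀ := by simp only [hf, h, T.arcInv_arc ht₀]
  -- A return to `t₀` would identify an interior point of the dart with its origin, a vertex. The
  -- intermediate value theorem then makes `f` sweep out a one-sided neighbourhood of `t₀`.
  have hfne : ∀ t ∈ Ioc 0 ε, f t ≠ t₀ := by
    intro t ht hft
    have h1 : S.dart d t = S.dart d 0 := by rw [← hfe t (Ioc_subset_Icc_self ht), hft, h]
    have h2 : S.dart d t ∈ S.openArc d.1 := S.dart_mem ⟨ht.1, by linarith [ht.2]⟩
    exact S.notMem_of_mem_openArc h2 (h1 ▸ hv)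
  have hivt := intermediate_value_uIcc (a := 0) (b := ε) (f := f) (by rwa [uIcc_of_le hε0.le])
  rw [uIcc_of_le hε0.le, hf0] at hivt
  have key : ∀ y ∈ uIcc t₀ (f ε), y ≠ t₀ → ∃ t ∈ Ioo (0 : ℝ) (1 / 2), S.dart d t = T.arc e' y := by
    intro y hy hyt
    obtain ⟨t, ht, rfl⟩ := hivt hy
    have : t ≠ 0 := fun h => hyt (h ▸ hf0)
    exact ⟨t, ⟨lt_of_le_of_ne ht.1 this.symm, by linarith [ht.2]⟩, (hfe t ht).symm⟩
  rcases lt_or_gt_of_ne (hfne ε ⟨hε0, le_rfl⟩) with hlt | hgt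
  · refine ⟨false, t₀ - f ε, sub_pos.2 hlt, fun s hs => ?_⟩
    refine key (t₀ - s) ?_ (by linarith [hs.1])
    rw [uIcc_of_ge hlt.le]
    constructor <;> linarith [hs.1, hs.2]
  · refine ⟨true, f ε - t₀, sub_pos.2 hgt, fun s hs => ?_⟩
    refine key (t₀ + s) ?_ (by linarith [hs.1])
    rw [uIcc_of_le hgt.le]
    constructor <;> linarith [hs.1, hs.2]

/-- An interior point of an arc has only two sides. If `x` were one, two of at least three darts
would cover the same side and overlap near their origin. -/
lemma mem_vertices_of_three_le_deg [T2Space X] [Fintype E] [Finite E'] {x : X}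
    (hx : x ∈ S.vertices) (h3 : 3 ≤ S.deg x) : x ∈ T.vertices := by
  classical
  by_contra hxT
  obtain ⟨e', t₀, ht₀, rfl⟩ := (T.cover x).resolve_left hxT
  rw [deg_eq_card] at h3
  have hside : ∀ d : E × Bool, S.dart d 0 = T.arc e' t₀ → ∃ b : Bool, ∃ δ > 0, ∀ s ∈ Ioo 0 δ,
      ∃ t ∈ Ioo (0 : ℝ) (1 / 2), S.dart d t = T.arc e' (bif b then t₀ + s else t₀ - s) :=
    fun d hd => S.dart_covers_side T (hd ▸ hx) ht₀ hd
  choose! b hb using hside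
  obtain ⟨d, hd, d', hd', hne, heq⟩ := Finset.exists_ne_map_eq_of_card_lt_of_maps_to
    (t := (Finset.univ : Finset Bool)) (f := b) (by simpa [Nat.lt_iff_add_one_le] using h3) (fun _ _ => Finset.mem_univ _)
  simp only [Finset.mem_filter, Finset.mem_univ, true_and] at hd hd'
  obtain ⟨δ, hδ, h⟩ := hb d hd
  obtain ⟨δ', hδ', h'⟩ := hb d' hd'
  have hm : 0 < min δ δ' := lt_min hδ hδ'
  obtain ⟨t, ht, hts⟩ := h (min δ δ' / 2) ⟨by linarith, by linarith [min_le_left δ δ']⟩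
  obtain ⟨t', ht', hts'⟩ := h' (min δ δ' / 2) ⟨by linarith, by linarith [min_le_right δ δ']⟩
  exact hne (S.dart_inj ht ht' (by rw [hts, hts', heq]))

/-- Decompositions all of whose vertices have valence at least three have the same vertices. -/
lemma vertices_eq_of_three_le_deg [T2Space X] [Fintype E] [Fintype E']
    (hS : ∀ x ∈ S.vertices, 3 ≤ S.deg x) (hT : ∀ x ∈ T.vertices, 3 ≤ T.deg x) :
    S.vertices = T.vertices :=
  subset_antisymm (fun x hx => S.mem_vertices_of_three_le_deg T hx (hS x hx))
    fun x hx => T.mem_vertices_of_three_le_deg S hx (hT x hx)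

/-- Decompositions with the same vertices have the same open arcs. -/
lemma exists_openArc_eq [T2Space X] [Finite E] [Finite E'] (h : S.vertices = T.vertices) (e : E) :
    ∃ e' : E', S.openArc e = T.openArc e' := by
  obtain ⟨e', t, ht, hte⟩ := (T.cover (S.arc e (1 / 2))).resolve_left
    (h ▸ S.notMem e _ half_mem)
  refine ⟨e', ?_⟩
  rw [← S.connectedComponentIn_compl_vertices (S.arc_half_mem_openArc e),
    ← T.connectedComponentIn_compl_vertices (x := S.arc e (1 / 2)) ⟨t, ht, hte⟩, h]

end ArcDecomp

/-! ### Merging arcs at vertices of valence two -/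

namespace ArcDecomp

variable {X : Type u} [TopologicalSpace X] {E : Type v} (S : ArcDecomp X E)

/-- Reverse the arcs `e` with `b e = true`. -/
def orient (b : E → Bool) : ArcDecomp X E where
  vertices := S.vertices
  arc e t := S.arc e (bif b e then 1 - t else t)
  continuous_arc e := S.continuous_dart (e, b e)
  zero_mem e := by cases b e <;> simp [S.zero_mem, S.one_mem]
  one_mem e := by cases b e <;> simp [S.zero_mem, S.one_mem]
  notMem e t ht := S.notMem_of_mem_openArc (S.dart_mem (d := (e, b e)) ht)
  inj e e' t t' ht ht' h := by
    have hI : ∀ (b : Bool) (t : ℝ), t ∈ Ioo (0 : ℝ) 1 →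
        (bif b then 1 - t else t) ∈ Ioo (0 : ℝ) 1 := by
      rintro (_ | _) t ht <;> simp_all
    obtain ⟨rfl, h'⟩ := S.inj _ _ _ _ (hI _ _ ht) (hI _ _ ht') h
    exact ⟨rfl, by cases hb : b e <;> simp_all⟩
  cover x := by
    rcases S.cover x with h | ⟨e, t, ht, rfl⟩
    · exact .inl h
    · refine .inr ⟨e, bif b e then 1 - t else t, ?_, ?_⟩ <;> cases b e <;> simp_all

lemma orient_dart (b : E → Bool) (e : E) (c : Bool) (t : ℝ) :
    (S.orient b).dart (e, c) t = S.dart (e, xor c (b e)) t := by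
  simp only [dart, orient]
  cases c <;> cases b e <;> simp

lemma orient_deg [Fintype E] (b : E → Bool) (x : X) : (S.orient b).deg x = S.deg x := by
  refine Finset.sum_congr rfl fun e _ => ?_
  classical
  change (if S.dart (e, b e) 0 = x then 1 else 0) + (if S.dart (e, b e) 1 = x then 1 else 0) = _
  cases b e <;> simp [dart, add_comm]

section Merge

variable {e₁ e₂ : E} {v : X}

open Classical in
/-- The arcs of the decomposition obtained by merging the arc `e₂` into the arc `e₁`. -/
noncomputable def mergeArc (e₁ e₂ : E) (e : E) (t : ℝ) : X :=
  if e = e₁ then if t ≤ 1 / 2 then S.arc e₁ (2 * t) else S.arc e₂ (2 * t - 1) else S.arc e t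

lemma continuous_mergeArc (h : S.arc e₁ 1 = S.arc e₂ 0) (e : E) :
    Continuous (S.mergeArc e₁ e₂ e) := by
  unfold mergeArc
  split_ifs with he
  · refine Continuous.if_le ((S.continuous_arc e₁).comp (by fun_prop))
      ((S.continuous_arc e₂).comp (by fun_prop)) continuous_id continuous_const ?_
    rintro _ rfl
    norm_num [h]
  · exact S.continuous_arc e

/-- Recovers the old arc and parameter from the new ones, so that injectivity of the merged
decomposition reduces to that of the old. -/
lemma mergeArc_cases (hv : S.arc e₁ 1 = v) {e : E} (he : e ≠ e₂) {t : ℝ}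
    (ht : t ∈ Ioo (0 : ℝ) 1) :
    (S.mergeArc e₁ e₂ e t = v ∧ e = e₁ ∧ t = 1 / 2) ∨
    ∃ f, ∃ s ∈ Ioo (0 : ℝ) 1, S.mergeArc e₁ e₂ e t = S.arc f s ∧
      ((f = e₂ ∧ e = e₁ ∧ t = (s + 1) / 2) ∨ (f = e₁ ∧ e = e₁ ∧ t = s / 2) ∨
        (f = e ∧ e ≠ e₁ ∧ e ≠ e₂ ∧ t = s)) := by
  simp only [mem_Ioo] at ht ⊢
  unfold mergeArc
  split_ifs with h h'
  · rcases h'.eq_or_lt with rfl | h''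
    · left; norm_num [h, hv]
    · exact .inr ⟨e₁, 2 * t, by constructor <;> linarith, rfl, .inr (.inl ⟨rfl, h, by ring⟩)⟩
  · exact .inr ⟨e₂, 2 * t - 1, by constructor <;> linarith, rfl, .inl ⟨rfl, h, by ring⟩⟩
  · exact .inr ⟨e, t, ht, rfl, .inr (.inr ⟨rfl, h, he, rfl⟩)⟩

open Classical in
/-- Merge two arcs that meet in a vertex of valence two. -/
noncomputable def merge (hne : e₁ ≠ e₂) (hv : v ∈ S.vertices) (hv₁ : S.arc e₁ 1 = v)
    (hv₂ : S.arc e₂ 0 = v) (h0 : ∀ e, S.arc e 0 = v → e = e₂) (h1 : ∀ e, S.arc e 1 = v → e = e₁) :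
    ArcDecomp X {e : E // e ≠ e₂} where
  vertices := S.vertices.erase v
  arc e := S.mergeArc e₁ e₂ e
  continuous_arc e := S.continuous_mergeArc (hv₁.trans hv₂.symm) e
  zero_mem := by
    rintro ⟨e, he⟩
    simp only [mergeArc, Finset.mem_erase]
    split_ifs with h h'
    · rw [mul_zero]; exact ⟨fun h' => hne (h0 _ h'), S.zero_mem _⟩
    · norm_num at h'
    · exact ⟨fun h' => he (h0 _ h'), S.zero_mem _⟩
  one_mem := by
    rintro ⟨e, he⟩
    simp only [mergeArc, Finset.mem_erase]
    split_ifs with h h'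
    · norm_num at h'
    · norm_num; exact ⟨fun h' => hne (h1 _ h').symm, S.one_mem _⟩
    · exact ⟨fun h' => h (h1 _ h'), S.one_mem _⟩
  notMem := by
    rintro ⟨e, he⟩ t ht h
    rw [Finset.mem_erase] at h
    rcases S.mergeArc_cases hv₁ he ht with h' | ⟨f, s, hs, h', -⟩
    · exact h.1 h'.1
    · exact S.notMem f s hs (h' ▸ h.2)
  inj := by
    rintro ⟨e, he⟩ ⟨e', he'⟩ t t' ht ht' h
    rw [Subtype.mk.injEq]
    rcases S.mergeArc_cases hv₁ he ht with ⟨h1, h2, h3⟩ | ⟨f, s, hs, h1, h2⟩ <;>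
    rcases S.mergeArc_cases hv₁ he' ht' with ⟨h1', h2', h3'⟩ | ⟨f', s', hs', h1', h2'⟩
    · exact ⟨h2.trans h2'.symm, h3.trans h3'.symm⟩
    · exact absurd (h1'.symm.trans (h.symm.trans h1) ▸ hv) (S.notMem _ _ hs')
    · exact absurd (h1.symm.trans (h.trans h1') ▸ hv) (S.notMem _ _ hs)
    · obtain ⟨rfl, rfl⟩ := S.inj f f' s s' hs hs' (h1.symm.trans (h.trans h1'))
      grind
  cover x := by
    rcases S.cover x with h | ⟨e, t, ht, rfl⟩
    · by_cases hx : x = v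
      · refine .inr ⟨⟨e₁, hne⟩, 1 / 2, half_mem, ?_⟩
        norm_num [mergeArc, hv₁, hx]
      · exact .inl (Finset.mem_erase.2 ⟨hx, h⟩)
    right
    by_cases h2 : e = e₂
    · refine ⟨⟨e₁, hne⟩, (t + 1) / 2, ⟨by linarith [ht.1], by linarith [ht.2]⟩, ?_⟩
      have : ¬ (t + 1) / 2 ≤ 1 / 2 := by linarith [ht.1]
      simp only [mergeArc, if_true, if_neg this, h2]
      ring_nf
    by_cases h1 : e = e₁
    · refine ⟨⟨e₁, hne⟩, t / 2, ⟨by linarith [ht.1], by linarith [ht.2]⟩, ?_⟩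
      have : t / 2 ≤ 1 / 2 := by linarith [ht.2]
      simp only [mergeArc, if_true, if_pos this, h1]
      ring_nf
    · exact ⟨⟨e, h2⟩, t, ht, by simp [mergeArc, h1]⟩

lemma sum_subtype_ne_add {α : Type*} [Fintype α] [DecidableEq α] (a : α) (f : α → ℕ) :
    ∑ x : {x : α // x ≠ a}, f x + f a = ∑ x, f x := by
  rw [← Finset.sum_erase_add _ _ (Finset.mem_univ a)]
  congr 1
  exact (Finset.sum_subtype _ (by simp) _).symm

lemma sum_subtype_ne_ite {α : Type*} [Fintype α] [DecidableEq α] {a b : α} (hab : a ≠ b)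
    (f : α → ℕ) (ha : f a = 0) :
    ∑ x : {x : α // x ≠ b}, (if x.1 = a then f b else f x) = ∑ x, f x := by
  have h1 := sum_subtype_ne_add b fun x => if x = a then f b else f x
  have h2 : ∑ x, (if x = a then f b else f x) = f b + ∑ x ∈ Finset.univ.erase a, f x := by
    rw [← Finset.add_sum_erase _ _ (Finset.mem_univ a), if_pos rfl]
    congr 1
    exact Finset.sum_congr rfl fun e he => if_neg (Finset.ne_of_mem_erase he)
  rw [← Finset.add_sum_erase _ f (Finset.mem_univ a), ha, zero_add]
  rw [h2, if_neg hab.symm] at h1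
  omega

lemma merge_deg [Fintype E] [Fintype {e : E // e ≠ e₂}] (hne : e₁ ≠ e₂) (hv : v ∈ S.vertices) (hv₁ : S.arc e₁ 1 = v)
    (hv₂ : S.arc e₂ 0 = v) (h0 : ∀ e, S.arc e 0 = v → e = e₂) (h1 : ∀ e, S.arc e 1 = v → e = e₁)
    {x : X} (hx : x ≠ v) : (S.merge hne hv hv₁ hv₂ h0 h1).deg x = S.deg x := by
  classical
  obtain rfl : ‹Fintype {e : E // e ≠ e₂}› = Subtype.fintype _ := Subsingleton.elim _ _
  simp only [deg, Finset.sum_add_distrib]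
  congr 1
  · rw [← sum_subtype_ne_add e₂ fun e => if S.arc e 0 = x then 1 else 0, hv₂, if_neg hx.symm,
      add_zero]
    refine Finset.sum_congr rfl fun ⟨e, he⟩ _ => ?_
    have : S.mergeArc e₁ e₂ e 0 = S.arc e 0 := by
      unfold mergeArc
      split_ifs with h h' <;> [simp [h]; norm_num at h'; rfl]
    simp only [merge, this]
  · rw [← sum_subtype_ne_ite hne (fun e => if S.arc e 1 = x then 1 else 0) (by simp [hv₁, hx.symm])]
    refine Finset.sum_congr rfl fun ⟨e, he⟩ _ => ?_
    simp only [merge, mergeArc]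
    split_ifs <;> norm_num at * <;> simp_all

end Merge

/-- Vertices of valence two can be removed from a decomposition of a connected space that has
more arcs than vertices. -/
theorem exists_merged [T2Space X] [PreconnectedSpace X] (k : ℕ) :
    ∀ (E : Type v) [Fintype E] (S : ArcDecomp X E), S.vertices.card = k →
      S.vertices.card < Fintype.card E →
      ∃ (E' : Type v) (_ : Fintype E') (S' : ArcDecomp X E'),
        (∀ x, x ∈ S'.vertices ↔ x ∈ S.vertices ∧ S.deg x ≠ 2) ∧
        ∀ x ∈ S'.vertices, S'.deg x = S.deg x := by
  classical
  induction k with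
  | zero =>
    intro E _ S hk _
    refine ⟨E, _, S, fun x => ?_, fun _ _ => rfl⟩
    simp [Finset.card_eq_zero.1 hk]
  | succ k ih =>
    intro E _ S hk hlt
    by_cases hex : ∃ v ∈ S.vertices, S.deg v = 2
    swap
    · push Not at hex
      exact ⟨E, _, S, fun x => ⟨fun h => ⟨h, hex x h⟩, fun h => h.1⟩, fun _ _ => rfl⟩
    obtain ⟨v, hv, hdeg⟩ := hex
    have hdeg' := hdeg
    rw [deg_eq_card, Finset.card_eq_two] at hdeg'
    obtain ⟨⟨e₁, b₁⟩, ⟨e₂, b₂⟩, hd, hset⟩ := hdeg'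
    have hmem : ∀ d : E × Bool, S.dart d 0 = v ↔ d = (e₁, b₁) ∨ d = (e₂, b₂) := by
      intro d
      simpa using Finset.ext_iff.1 hset d
    -- Otherwise a loop at `v` has no other arcs attached, so it is the whole space. One vertex and
    -- one arc contradict the strict inequality of the counts.
    have hne : e₁ ≠ e₂ := by
      rintro rfl
      have hb : b₂ = !b₁ := by cases b₁ <;> cases b₂ <;> simp_all
      subst hb
      have hends : ∀ c, S.dart (e₁, c) 0 = v := fun c => (hmem _).2 (by cases b₁ <;> cases c <;> simp)
      have hother : ∀ e ∉ ({e₁} : Set E), ∀ c, S.dart (e, c) 0 ≠ v := by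
        intro e he c h
        rcases (hmem _).1 h with h | h <;> exact he (Prod.ext_iff.1 h).1
      obtain ⟨hW, hA⟩ := S.eq_vertices_of_closed_under_arcs (W := {v}) (A := {e₁}) (by simp)
        (by simpa using hv)
        (by
          rintro e rfl
          have h0 := hends false
          have h1 := hends true
          simp only [dart, cond_false, cond_true, sub_zero] at h0 h1
          simp [h0, h1])
        (by
          intro e he
          have h0 := hother e he false
          have h1 := hother e he true
          simp only [dart, cond_false, cond_true, sub_zero] at h0 h1
          simp [h0, h1])
      have : Fintype.card E ≤ 1 := by
        rw [Fintype.card_le_one_iff]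
        intro a b
        have ha : a ∈ ({e₁} : Set E) := hA ▸ mem_univ a
        have hb : b ∈ ({e₁} : Set E) := hA ▸ mem_univ b
        rw [mem_singleton_iff] at ha hb
        rw [ha, hb]
      rw [← hW, Finset.card_singleton] at hlt
      omega
    -- Orientation making `e₁` end at `v` and `e₂` start there, as merging requires.
    set b : E → Bool := fun e => if e = e₁ then !b₁ else if e = e₂ then b₂ else false with hb
    have hb1 : b e₁ = !b₁ := by simp [hb]
    have hb2 : b e₂ = b₂ := by simp [hb, hne.symm]
    have ho : ∀ e c, (S.orient b).dart (e, c) 0 = v ↔ (e, c) = (e₁, true) ∨ (e, c) = (e₂, false) := by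
      intro e c
      have hx1 : ∀ c b : Bool, xor c (!b) = b ↔ c = true := by decide
      have hx2 : ∀ c b : Bool, xor c b = b ↔ c = false := by decide
      rw [orient_dart, hmem]
      simp only [Prod.mk.injEq]
      refine or_congr (and_congr_right ?_) (and_congr_right ?_)
      · rintro rfl
        rw [hb1, hx1]
      · rintro rfl
        rw [hb2, hx2]
    have hd0 : ∀ e, (S.orient b).dart (e, false) 0 = (S.orient b).arc e 0 := fun e => by simp [dart]
    have hd1 : ∀ e, (S.orient b).dart (e, true) 0 = (S.orient b).arc e 1 := fun e => by simp [dart]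
    have hv₁ : (S.orient b).arc e₁ 1 = v := by rw [← hd1, ho]; exact .inl rfl
    have hv₂ : (S.orient b).arc e₂ 0 = v := by rw [← hd0, ho]; exact .inr rfl
    have h0 : ∀ e, (S.orient b).arc e 0 = v → e = e₂ := by
      intro e h
      rw [← hd0, ho] at h
      simpa using h
    have h1 : ∀ e, (S.orient b).arc e 1 = v → e = e₁ := by
      intro e h
      rw [← hd1, ho] at h
      simpa using h
    set S₁ := (S.orient b).merge hne hv hv₁ hv₂ h0 h1
    have hvert : S₁.vertices = S.vertices.erase v := rfl
    have hdeg₁ : ∀ x, x ≠ v → S₁.deg x = S.deg x := fun x hx =>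
      ((S.orient b).merge_deg hne hv hv₁ hv₂ h0 h1 hx).trans (S.orient_deg b x)
    have hc1 : S₁.vertices.card = k := by
      rw [hvert, Finset.card_erase_of_mem hv, hk, Nat.add_sub_cancel]
    have hc2 : Fintype.card {e // e ≠ e₂} = Fintype.card E - 1 := by
      rw [Fintype.card_subtype_compl, Fintype.card_subtype_eq]
    -- Merging removes one vertex and one arc, so there are still more arcs than vertices.
    obtain ⟨E', _, S', hS', hS''⟩ := ih {e // e ≠ e₂} S₁ hc1 (by omega)
    have hnv : ∀ x, x ∈ S'.vertices → x ≠ v := fun x hx =>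
      (Finset.mem_erase.1 ((hS' x).1 hx).1).1
    refine ⟨E', _, S', fun x => ?_, fun x hx => by rw [hS'' x hx, hdeg₁ x (hnv x hx)]⟩
    rw [hS', hvert, Finset.mem_erase]
    by_cases hx : x = v
    · simp [hx, hdeg]
    · simp [hx, hdeg₁ x hx]

end ArcDecomp

/-! ### From the CW structure to the natural decomposition -/

section CW

variable (X : Type u) [TopologicalSpace X] [CWComplex (univ : Set X)]

/-- The affine parametrization of the one-dimensional unit ball by the unit interval, constant
outside of the unit interval. -/
def intervalParam (t : ℝ) : Fin 1 → ℝ := fun _ => max (-1) (min (2 * t - 1) 1)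

lemma continuous_intervalParam : Continuous intervalParam := by
  unfold intervalParam
  fun_prop

lemma intervalParam_zero : intervalParam 0 = -1 := by
  funext i
  norm_num [intervalParam]

lemma intervalParam_one : intervalParam 1 = 1 := by
  funext i
  norm_num [intervalParam]

lemma intervalParam_apply {t : ℝ} (ht : t ∈ Icc (0 : ℝ) 1) (i : Fin 1) :
    intervalParam t i = 2 * t - 1 := by
  rw [intervalParam, min_eq_left (by linarith [ht.2]), max_eq_right (by linarith [ht.1])]

lemma intervalParam_mem_closedBall (t : ℝ) : intervalParam t ∈ Metric.closedBall 0 1 := by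
  rw [mem_closedBall_zero_iff, pi_norm_le_iff_of_nonneg zero_le_one]
  intro i
  rw [Real.norm_eq_abs, abs_le, intervalParam]
  exact ⟨le_max_left _ _, max_le (by norm_num) (min_le_right _ _)⟩

lemma intervalParam_mem_ball {t : ℝ} (ht : t ∈ Ioo (0 : ℝ) 1) :
    intervalParam t ∈ Metric.ball 0 1 := by
  rw [mem_ball_zero_iff, pi_norm_lt_iff zero_lt_one]
  intro i
  rw [intervalParam_apply (Ioo_subset_Icc_self ht), Real.norm_eq_abs, abs_lt]
  constructor <;> linarith [ht.1, ht.2]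

open Classical in
/-- The decomposition of a finite graph given by its cells. -/
noncomputable def cellDecomp [Fintype (cell (univ : Set X) 0)]
    (hX : ∀ m, 2 ≤ m → IsEmpty (cell (univ : Set X) m)) : ArcDecomp X (cell (univ : Set X) 1) where
  vertices := Finset.univ.image fun w : cell (univ : Set X) 0 => map 0 w ![]
  arc e t := map 1 e (intervalParam t)
  continuous_arc e := by
    have h := (RelCWComplex.continuousOn (C := (univ : Set X)) 1 e).comp
      continuous_intervalParam.continuousOn (s := univ) fun t _ => intervalParam_mem_closedBall t
    rwa [← continuousOn_univ]
  zero_mem e := by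
    obtain ⟨x, y, h⟩ := CWComplex.exists_cellFrontier_one_eq e
    have hm : map 1 e (-1) ∈ cellFrontier 1 e := by
      rw [RelCWComplex.cellFrontier_one_eq]
      exact ⟨-1, by simp, rfl⟩
    rw [h, RelCWComplex.closedCell_zero_eq_singleton, RelCWComplex.closedCell_zero_eq_singleton] at hm
    rw [intervalParam_zero, Finset.mem_image]
    rcases hm with hm | hm
    exacts [⟨x, Finset.mem_univ _, hm.symm⟩, ⟨y, Finset.mem_univ _, hm.symm⟩]
  one_mem e := by
    obtain ⟨x, y, h⟩ := CWComplex.exists_cellFrontier_one_eq e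
    have hm : map 1 e 1 ∈ cellFrontier 1 e := by
      rw [RelCWComplex.cellFrontier_one_eq]
      exact ⟨1, by simp, rfl⟩
    rw [h, RelCWComplex.closedCell_zero_eq_singleton, RelCWComplex.closedCell_zero_eq_singleton] at hm
    rw [intervalParam_one, Finset.mem_image]
    rcases hm with hm | hm
    exacts [⟨x, Finset.mem_univ _, hm.symm⟩, ⟨y, Finset.mem_univ _, hm.symm⟩]
  notMem e t ht h := by
    obtain ⟨w, -, hw⟩ := Finset.mem_image.1 h
    have hd := RelCWComplex.disjoint_openCell_of_ne (C := (univ : Set X)) (n := 1) (m := 0)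
      (i := e) (j := w) (by simp)
    refine disjoint_left.1 hd ⟨_, intervalParam_mem_ball ht, rfl⟩ ?_
    rw [RelCWComplex.openCell_zero_eq_singleton]
    exact hw.symm
  inj e e' t t' ht ht' h := by
    obtain rfl : e = e' := by
      have := RelCWComplex.eq_of_not_disjoint_openCell (C := (univ : Set X)) (n := 1) (m := 1)
        (j := e) (i := e') (not_disjoint_iff.2
          ⟨_, ⟨_, intervalParam_mem_ball ht, rfl⟩, ⟨_, intervalParam_mem_ball ht', h.symm⟩⟩)
      simpa using this
    refine ⟨rfl, ?_⟩
    have hs := RelCWComplex.source_eq (C := (univ : Set X)) 1 e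
    have := (map 1 e).injOn (hs ▸ intervalParam_mem_ball ht) (hs ▸ intervalParam_mem_ball ht') h
    have := congrFun this 0
    rw [intervalParam_apply (Ioo_subset_Icc_self ht), intervalParam_apply (Ioo_subset_Icc_self ht')]
      at this
    linarith
  cover x := by
    have hx : x ∈ ⋃ (n : ℕ) (j : cell (univ : Set X) n), openCell n j := by
      rw [CWComplex.iUnion_openCell_eq_complex]; trivial
    obtain ⟨n, j, hj⟩ := by simpa only [mem_iUnion] using hx
    match n, j, hj with
    | 0, j, hj =>
      rw [RelCWComplex.openCell_zero_eq_singleton] at hj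
      exact .inl (Finset.mem_image.2 ⟨j, Finset.mem_univ _, hj.symm⟩)
    | 1, j, hj =>
      obtain ⟨y, hy, rfl⟩ := hj
      rw [mem_ball_zero_iff, pi_norm_lt_iff zero_lt_one] at hy
      have h0 := hy 0
      rw [Real.norm_eq_abs, abs_lt] at h0
      have ht : (y 0 + 1) / 2 ∈ Ioo (0 : ℝ) 1 := by constructor <;> linarith [h0.1, h0.2]
      refine .inr ⟨j, (y 0 + 1) / 2, ht, congrArg _ (funext fun i => ?_)⟩
      rw [intervalParam_apply (Ioo_subset_Icc_self ht), Subsingleton.elim i 0]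
      ring
    | m + 2, j, _ => exact ((hX (m + 2) (by omega)).false j).elim

lemma cellDecomp_deg [Fintype (cell (univ : Set X) 0)] [Fintype (cell (univ : Set X) 1)]
    (hX : ∀ m, 2 ≤ m → IsEmpty (cell (univ : Set X) m)) (w : cell (univ : Set X) 0) :
    (cellDecomp X hX).deg (map 0 w ![]) = valence X w := by
  classical
  simp only [ArcDecomp.deg, cellDecomp, intervalParam_zero, intervalParam_one,
    Finset.sum_add_distrib, valence, Nat.card_eq_fintype_card, Fintype.card_subtype,
    Finset.card_filter]

end CW

/-- A core graph of rank at least two has a decomposition whose vertices are the natural ones, and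
these have valence at least three. -/
theorem IsCoreGraph.exists_natural_decomp {X : Type u} [TopologicalSpace X]
    [CWComplex (univ : Set X)] [T2Space X] {n : ℕ} (hn : 2 ≤ n) (hX : IsCoreGraph X n) :
    ∃ (E : Type u) (_ : Fintype E) (S : ArcDecomp X E), naturalVertices X = S.vertices ∧
      ∀ x ∈ S.vertices, 3 ≤ S.deg x := by
  classical
  have := hX.connected
  have := hX.finite.finite_cell 0
  have := hX.finite.finite_cell 1
  have := Fintype.ofFinite (cell (univ : Set X) 0)
  have := Fintype.ofFinite (cell (univ : Set X) 1)
  set S := cellDecomp X hX.isEmpty_cell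
  have hmem : ∀ x, x ∈ S.vertices ↔ ∃ w : cell (univ : Set X) 0, map 0 w ![] = x := fun x => by
    simp [S, cellDecomp]
  have hcard : S.vertices.card = Nat.card (cell (univ : Set X) 0) := by
    rw [Nat.card_eq_fintype_card, ← Finset.card_univ]
    exact Finset.card_image_of_injective _ (RelCWComplex.injective_map_zero univ)
  have hrank := hX.rank_eq
  -- Rank at least two enters here: |E| - |V| = n - 1 ≥ 1, so the graph is neither a point nor a
  -- circle.
  have hlt : S.vertices.card < Fintype.card (cell (univ : Set X) 1) := by
    rw [hcard, ← Nat.card_eq_fintype_card]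
    omega
  obtain ⟨E, hE, S', h1, h2⟩ := ArcDecomp.exists_merged _ _ S rfl hlt
  refine ⟨E, hE, S', ?_, fun x hx => ?_⟩
  · ext x
    simp only [naturalVertices, mem_ofPred_eq, Finset.mem_coe, h1, hmem]
    constructor
    · rintro ⟨w, hw, rfl⟩
      exact ⟨⟨w, rfl⟩, by rwa [cellDecomp_deg]⟩
    · rintro ⟨⟨w, rfl⟩, hw⟩
      exact ⟨w, by rwa [cellDecomp_deg] at hw, rfl⟩
  · rw [h2 x hx]
    obtain ⟨hxS, hne2⟩ := (h1 x).1 hx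
    obtain ⟨w, rfl⟩ := (hmem x).1 hxS
    have hne1 : S.deg (map 0 w ![]) ≠ 1 := by
      rw [cellDecomp_deg]
      exact hX.valence_ne_one w
    -- An isolated vertex would be the whole connected space, leaving no edges.
    have hne0 : S.deg (map 0 w ![]) ≠ 0 := by
      intro h0
      rw [ArcDecomp.deg, Finset.sum_eq_zero_iff] at h0
      obtain ⟨hV, hA⟩ := S.eq_vertices_of_closed_under_arcs (W := {map 0 w ![]}) (A := ∅) (by simp)
        (by simpa using hxS) (by simp) (fun e _ => by
          have := h0 e (Finset.mem_univ e)
          constructor <;> intro h <;> rw [Finset.mem_singleton] at h <;> simp [h] at this)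
      have hE : IsEmpty (cell (univ : Set X) 1) := univ_eq_empty_iff.1 hA.symm
      rw [Fintype.card_eq_zero] at hlt
      omega
    omega

/-! ### Covering spaces of a graph with group-labelled arcs -/

namespace ArcDecomp

variable {X : Type u} [TopologicalSpace X] {E : Type v} (S : ArcDecomp X E)
  {F : Type w} [Group F] (c : E → F)

open Classical in
/-- The index of the arc whose midpoint is `x`, if there is one. -/
noncomputable def midIndex (x : X) : Option E :=
  if h : ∃ e, x = S.arc e (1 / 2) then some h.choose else none

lemma midIndex_mid (e : E) : S.midIndex (S.arc e (1 / 2)) = some e := by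
  have h : ∃ e', S.arc e (1 / 2) = S.arc e' (1 / 2) := ⟨e, rfl⟩
  rw [midIndex, dif_pos h]
  exact congrArg some (S.inj _ _ _ _ half_mem half_mem h.choose_spec).1.symm

lemma midIndex_eq_none {x : X} (h : ∀ e, x ≠ S.arc e (1 / 2)) : S.midIndex x = none := by
  rw [midIndex, dif_neg]
  push Not
  exact h

open Classical in
/-- The label acquired by a point when it is seen from the midpoint of an arc: the points in the
second half of the arc `e` have label `c e`. -/
noncomputable def halfLabel : Option E → X → F
  | none, _ => 1
  | some e, x => if x ∈ S.arc e '' Ioo (1 / 2) 1 then c e else 1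

lemma halfLabel_midIndex (x : X) : S.halfLabel c (S.midIndex x) x = 1 := by
  by_cases h : ∃ e, x = S.arc e (1 / 2)
  · obtain ⟨e, rfl⟩ := h
    rw [midIndex_mid, halfLabel, if_neg]
    rintro ⟨t, ht, hte⟩
    have := (S.inj e e t (1 / 2) ⟨by linarith [ht.1], ht.2⟩ half_mem hte).2
    linarith [ht.1]
  · push Not at h
    rw [S.midIndex_eq_none h, halfLabel]

/-- The sets over which the covering space with labels `c` is trivial. -/
def chartSet : Option E → Set X
  | none => {x | ∀ e, x ≠ S.arc e (1 / 2)}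
  | some e => S.openArc e

lemma isOpen_chartSet [T2Space X] [Finite E] (i : Option E) : IsOpen (S.chartSet i) := by
  cases i with
  | none =>
    have : S.chartSet none = (range fun e => S.arc e (1 / 2))ᶜ := by
      ext x
      simp [chartSet, eq_comm]
    rw [this]
    exact (finite_range _).isClosed.isOpen_compl
  | some e => exact S.isOpen_openArc e

lemma mem_chartSet_midIndex (x : X) : x ∈ S.chartSet (S.midIndex x) := by
  by_cases h : ∃ e, x = S.arc e (1 / 2)
  · obtain ⟨e, rfl⟩ := h
    rw [midIndex_mid]
    exact S.arc_half_mem_openArc e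
  · push Not at h
    rw [S.midIndex_eq_none h]
    exact h

lemma eventually_halfLabel_eq [T2Space X] [Finite E] {e : E} {x : X} (hx : x ∈ S.openArc e)
    (hx' : x ≠ S.arc e (1 / 2)) :
    ∀ᶠ y in 𝓝 x, S.halfLabel c (some e) y = S.halfLabel c (some e) x := by
  obtain ⟨t, ht, rfl⟩ := hx
  have hfirst : ∀ s ∈ Ioo (0 : ℝ) (1 / 2), S.halfLabel c (some e) (S.arc e s) = 1 := by
    intro s hs
    rw [halfLabel, if_neg]
    rintro ⟨r, hr, hrs⟩
    have := (S.inj e e r s ⟨by linarith [hr.1], hr.2⟩ ⟨hs.1, by linarith [hs.2]⟩ hrs).2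
    linarith [hr.1, hs.2]
  have hsecond : ∀ s ∈ Ioo (1 / 2 : ℝ) 1, S.halfLabel c (some e) (S.arc e s) = c e := fun s hs => by
    rw [halfLabel, if_pos ⟨s, hs, rfl⟩]
  rcases lt_trichotomy t (1 / 2) with h | h | h
  · filter_upwards [(S.isOpen_image_arc e (isOpen_Ioo (a := 0) (b := 1 / 2))
      fun s hs => ⟨hs.1, by linarith [hs.2]⟩).mem_nhds ⟨t, ⟨ht.1, h⟩, rfl⟩]
    rintro _ ⟨s, hs, rfl⟩
    rw [hfirst s hs, hfirst t ⟨ht.1, h⟩]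
  · exact absurd (h ▸ rfl) hx'
  · filter_upwards [(S.isOpen_image_arc e (isOpen_Ioo (a := 1 / 2) (b := 1))
      fun s hs => ⟨by linarith [hs.1], hs.2⟩).mem_nhds ⟨t, ⟨h, ht.2⟩, rfl⟩]
    rintro _ ⟨s, hs, rfl⟩
    rw [hsecond s hs, hsecond t ⟨h, ht.2⟩]

/-- Labels jump only at midpoints, which the chart `none` omits, and the charts of distinct arcs are
disjoint. So the transition functions are locally constant and define a bundle with discrete fibre.
-/
lemma eventually_halfLabel_mul_inv_eq [T2Space X] [Finite E] {i j : Option E} {x : X}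
    (hi : x ∈ S.chartSet i) (hj : x ∈ S.chartSet j) :
    ∀ᶠ y in 𝓝 x, S.halfLabel c i y * (S.halfLabel c j y)⁻¹ =
      S.halfLabel c i x * (S.halfLabel c j x)⁻¹ := by
  cases i with
  | none =>
    cases j with
    | none => exact .of_forall fun y => rfl
    | some e =>
      filter_upwards [S.eventually_halfLabel_eq c hj (hi e)] with y hy
      rw [hy]; rfl
  | some e =>
    cases j with
    | none =>
      filter_upwards [S.eventually_halfLabel_eq c hi (hj e)] with y hy
      rw [hy]; rfl
    | some e' =>
      obtain rfl := S.eq_of_mem_openArc hi hj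
      simp

/-- The covering space in which crossing the arc `e` multiplies the fibre coordinate by `c e`. -/
noncomputable def bundleCore [T2Space X] [Finite E] [TopologicalSpace F] [DiscreteTopology F] :
    FiberBundleCore (Option E) X F where
  baseSet := S.chartSet
  isOpen_baseSet := S.isOpen_chartSet
  indexAt := S.midIndex
  mem_baseSet_at := S.mem_chartSet_midIndex
  coordChange i j x g := g * (S.halfLabel c i x * (S.halfLabel c j x)⁻¹)
  coordChange_self i x _ g := by simp
  continuousOn_coordChange i j := by
    rintro ⟨x, g⟩ ⟨⟨hi, hj⟩, -⟩
    refine ContinuousAt.continuousWithinAt ?_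
    have h1 : ContinuousAt (fun p : X × F => p.2) (x, g) := continuousAt_snd
    have h2 := (continuousAt_fst (p := (x, g))).eventually (S.eventually_halfLabel_mul_inv_eq c hi hj)
    have h3 := continuous_of_discreteTopology (f := fun a : F =>
      a * (S.halfLabel c i x * (S.halfLabel c j x)⁻¹))
    refine (h3.continuousAt.comp h1).congr ?_
    filter_upwards [h2] with p hp
    simp only [Function.comp, hp]
  coordChange_comp i j k x _ g := by group

/-- `g` is the fibre coordinate of a lift of `γ` to the covering space with labels `c`. -/
def IsLift {Z : Type*} [TopologicalSpace Z] (γ : Z → X) (g : Z → F) : Prop :=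
  ∀ z, ∀ᶠ z' in 𝓝 z, g z' = g z * S.halfLabel c (S.midIndex (γ z)) (γ z')

variable {S c}

lemma IsLift.comp {Y Z : Type*} [TopologicalSpace Y] [TopologicalSpace Z] {γ : Z → X} {g : Z → F}
    (h : S.IsLift c γ g) {k : Y → Z} (hk : Continuous k) : S.IsLift c (γ ∘ k) (g ∘ k) := fun y =>
  hk.continuousAt.eventually (h (k y))

/-- Labels act on the right, so they cancel in `g z * (g' z)⁻¹`, which is therefore locally
constant. -/
lemma IsLift.unique {Z : Type*} [TopologicalSpace Z] [PreconnectedSpace Z] {γ : Z → X}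
    {g g' : Z → F} (h : S.IsLift c γ g) (h' : S.IsLift c γ g') (z z' : Z) :
    g z * (g' z)⁻¹ = g z' * (g' z')⁻¹ := by
  have hl : IsLocallyConstant fun z => g z * (g' z)⁻¹ := by
    rw [IsLocallyConstant.iff_eventually_eq]
    intro z
    filter_upwards [h z, h' z] with y hy hy'
    rw [hy, hy']
    group
  exact hl.apply_eq_of_preconnectedSpace z z'

variable (S c)

/-- The bundle with discrete fibre is a covering, so the lifting criterion applies. Near `z`, the
lift is constant in the chart selected at `γ z`; rewriting this in the chosen fibre coordinate gives
the local rule. -/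
lemma exists_isLift [T2Space X] [Finite E] {Z : Type*} [TopologicalSpace Z]
    [SimplyConnectedSpace Z] [LocallyPathConnectedSpace Z] {γ : Z → X} (hγ : Continuous γ) :
    ∃ g : Z → F, S.IsLift c γ g := by
  let _ : TopologicalSpace F := ⊥
  have : DiscreteTopology F := ⟨rfl⟩
  let B := S.bundleCore c
  have hcov : IsCoveringMap (Bundle.TotalSpace.proj : B.TotalSpace → X) :=
    FiberBundle.isCoveringMap
  obtain ⟨z₀⟩ : Nonempty Z := inferInstance
  obtain ⟨Γ, ⟨-, hΓ⟩, -⟩ := hcov.existsUnique_continuousMap_lifts ⟨γ, hγ⟩ z₀ ⟨γ z₀, (1 : F)⟩ rfl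
  have hproj : ∀ z, (Γ z).1 = γ z := fun z => congrFun hΓ z
  let g : Z → F := fun z => (Γ z).2
  refine ⟨g, fun z => ?_⟩
  set i := S.midIndex (γ z)
  have hsrc : Γ z ∈ (B.localTriv i).source := by
    rw [FiberBundleCore.mem_localTriv_source, ← FiberBundleCore.baseSet_at, hproj]
    exact S.mem_chartSet_midIndex (γ z)
  have hct : ContinuousAt (fun z' => (B.localTriv i (Γ z')).2) z :=
    continuousAt_snd.comp (((B.localTriv i).continuousAt hsrc).comp Γ.continuous.continuousAt)
  have hval : ∀ z', (B.localTriv i (Γ z')).2 =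
      g z' * (S.halfLabel c i (γ z'))⁻¹ := by
    intro z'
    rw [FiberBundleCore.localTriv_apply]
    change g z' * (S.halfLabel c (S.midIndex (Γ z').1) (Γ z').1 *
      (S.halfLabel c i (Γ z').1)⁻¹) = _
    rw [halfLabel_midIndex, hproj, one_mul]
  filter_upwards [hct.eventually_mem ((isOpen_discrete {_}).mem_nhds rfl)] with z' hz'
  rw [mem_singleton_iff] at hz'
  rw [hval, hval, halfLabel_midIndex, inv_one, mul_one, mul_inv_eq_iff_eq_mul] at hz'
  exact hz'

end ArcDecomp

/-! ### Monodromy along paths and under homotopies -/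

namespace ArcDecomp

variable {X : Type u} [TopologicalSpace X] {E : Type v} (S : ArcDecomp X E)
  {F : Type w} [Group F] (c : E → F)

/-- The path `γ` restricted to the unit interval has monodromy `a` in the covering space with
labels `c`. -/
def Transports (γ : ℝ → X) (a : F) : Prop :=
  ∃ g : unitInterval → F, S.IsLift c (fun t : unitInterval => γ t) g ∧ g 1 = g 0 * a

variable {S c}

lemma Transports.unique {γ : ℝ → X} {a b : F} (ha : S.Transports c γ a)
    (hb : S.Transports c γ b) : a = b := by
  obtain ⟨g, hg, hga⟩ := ha
  obtain ⟨g', hg', hgb⟩ := hb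
  have h := hg.unique hg' 1 0
  rw [hga, hgb] at h
  have h' : g 0 * (a * b⁻¹) * (g' 0)⁻¹ = g 0 * 1 * (g' 0)⁻¹ := by
    rw [mul_one, ← h]
    group
  exact mul_inv_eq_one.1 (mul_left_cancel (mul_right_cancel h'))

lemma Transports.congr {γ γ' : ℝ → X} {a : F} (ha : S.Transports c γ a)
    (h : ∀ t ∈ Icc (0 : ℝ) 1, γ' t = γ t) : S.Transports c γ' a := by
  obtain ⟨g, hg, hga⟩ := ha
  refine ⟨g, ?_, hga⟩
  have : (fun t : unitInterval => γ' t) = fun t : unitInterval => γ t := funext fun t => h t t.2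
  rwa [this]

lemma IsLift.transports_unitInterval {γ : ℝ → X} {g : unitInterval → F}
    (h : S.IsLift c (fun t : unitInterval => γ t) g) : S.Transports c γ ((g 0)⁻¹ * g 1) :=
  ⟨g, h, by group⟩

lemma IsLift.transports {γ : ℝ → X} {g : ℝ → F} (h : S.IsLift c γ g) :
    S.Transports c γ ((g 0)⁻¹ * g 1) :=
  (h.comp (Y := unitInterval) continuous_subtype_val).transports_unitInterval

lemma Transports.comp {γ : ℝ → X} {a : F} (ha : S.Transports c γ a) {τ : ℝ → ℝ}
    (hτ : Continuous τ) (hI : MapsTo τ (Icc 0 1) (Icc 0 1)) (h0 : τ 0 = 0) (h1 : τ 1 = 1) :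
    S.Transports c (γ ∘ τ) a := by
  obtain ⟨g, hg, hga⟩ := ha
  have hk : Continuous (hI.restrict τ (Icc 0 1) (Icc 0 1)) := hτ.continuousOn.mapsToRestrict hI
  refine ⟨_, hg.comp (Y := unitInterval) hk, ?_⟩
  have e0 : hI.restrict τ (Icc 0 1) (Icc 0 1) 0 = 0 := Subtype.ext h0
  have e1 : hI.restrict τ (Icc 0 1) (Icc 0 1) 1 = 1 := Subtype.ext h1
  simp only [Function.comp]
  rw [e0, e1, hga]

lemma Transports.reverse {γ : ℝ → X} {a : F} (ha : S.Transports c γ a) :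
    S.Transports c (fun t => γ (1 - t)) a⁻¹ := by
  obtain ⟨g, hg, hga⟩ := ha
  refine ⟨_, hg.comp (Y := unitInterval) unitInterval.continuous_symm, ?_⟩
  simp [hga]

variable (S c)

lemma transports_const {γ : ℝ → X} (h : ∀ t ∈ Icc (0 : ℝ) 1, γ t = γ 0) :
    S.Transports c γ 1 := by
  refine Transports.congr (γ := fun _ => γ 0) ⟨fun _ => 1, fun z => ?_, by simp⟩ h
  simp [halfLabel_midIndex]

lemma exists_transports [T2Space X] [Finite E] {γ : ℝ → X} (hγ : Continuous γ) :
    ∃ a, S.Transports c γ a := by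
  obtain ⟨g, hg⟩ := S.exists_isLift c hγ
  exact ⟨_, hg.transports⟩

/-- The lift is explicit: a single jump after the midpoint, the midpoint itself counting with the
first half. -/
lemma transports_arc (e : E) : S.Transports c (S.arc e) (c e) := by
  classical
  refine ⟨fun t : unitInterval => if (1 / 2 : ℝ) < t then c e else 1, fun t => ?_, by norm_num⟩
  have hlabel : ∀ s ∈ Ioo (0 : ℝ) 1, S.halfLabel c (some e) (S.arc e s) =
      if (1 / 2 : ℝ) < s then c e else 1 := by
    intro s hs
    rw [halfLabel]
    congr 1
    refine propext ⟨?_, fun h => ⟨s, ⟨h, hs.2⟩, rfl⟩⟩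
    rintro ⟨r, hr, hrs⟩
    rw [← (S.inj e e r s ⟨by linarith [hr.1], hr.2⟩ hs hrs).2]
    exact hr.1
  rcases lt_trichotomy (1 / 2 : ℝ) t with h | h | h
  · have hn : S.midIndex (S.arc e t) = none := by
      refine S.midIndex_eq_none fun e' he' => ?_
      rcases mem_Icc_cases t.2 with h' | h' | h'
      · rw [h'] at h; norm_num at h
      · exact S.notMem e' _ half_mem (he' ▸ h' ▸ S.one_mem e)
      · exact h.ne' (S.inj _ _ _ _ h' half_mem he').2
    filter_upwards [(continuous_subtype_val.continuousAt (x := t)).eventually (lt_mem_nhds h)]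
      with s hs
    rw [hn, if_pos hs, if_pos h, halfLabel, mul_one]
  · beta_reduce
    rw [← h, midIndex_mid]
    filter_upwards [(continuous_subtype_val.continuousAt (x := t)).eventually
      (Ioo_mem_nhds (h ▸ half_mem.1) (h ▸ half_mem.2))] with s hs
    rw [hlabel s hs, if_neg (lt_irrefl _), one_mul]
  · have hn : S.midIndex (S.arc e t) = none := by
      refine S.midIndex_eq_none fun e' he' => ?_
      rcases mem_Icc_cases t.2 with h' | h' | h'
      · exact S.notMem e' _ half_mem (he' ▸ h' ▸ S.zero_mem e)
      · rw [h'] at h; norm_num at h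
      · exact h.ne (S.inj _ _ _ _ h' half_mem he').2
    filter_upwards [(continuous_subtype_val.continuousAt (x := t)).eventually (gt_mem_nhds h)]
      with s hs
    rw [hn, if_neg hs.not_gt, if_neg h.not_gt, halfLabel, mul_one]

/-- One lift of `R` over the simply connected plane restricts to all four sides, and both products
telescope to the ratio between opposite corners. -/
lemma transports_square [T2Space X] [Finite E] {R : ℝ × ℝ → X} (hR : Continuous R) {a b h k : F}
    (ha : S.Transports c (fun t => R (0, t)) a) (hb : S.Transports c (fun t => R (1, t)) b)
    (hh : S.Transports c (fun s => R (s, 0)) h) (hk : S.Transports c (fun s => R (s, 1)) k) :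
    h * b = a * k := by
  obtain ⟨g, hg⟩ := S.exists_isLift c hR
  rw [ha.unique (hg.comp (k := fun t : ℝ => ((0 : ℝ), t)) (by fun_prop)).transports,
    hb.unique (hg.comp (k := fun t : ℝ => ((1 : ℝ), t)) (by fun_prop)).transports,
    hh.unique (hg.comp (k := fun s : ℝ => (s, (0 : ℝ))) (by fun_prop)).transports,
    hk.unique (hg.comp (k := fun s : ℝ => (s, (1 : ℝ))) (by fun_prop)).transports]
  simp only [Function.comp]
  group

/-- Homotopic maps have conjugate monodromies. -/
theorem exists_conj_of_homotopic [T2Space X] [Finite E] {Y : Type*} [TopologicalSpace Y]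
    {f₀ f₁ : C(Y, X)} (hf : f₀.Homotopic f₁) :
    ∃ h : Y → F, ∀ γ : ℝ → Y, Continuous γ → ∀ a b, S.Transports c (fun t => f₀ (γ t)) a →
      S.Transports c (fun t => f₁ (γ t)) b → h (γ 0) * b = a * h (γ 1) := by
  obtain ⟨H⟩ := hf
  have hc : ∀ y, Continuous fun s : ℝ => H (projIcc (0 : ℝ) 1 zero_le_one s, y) := fun y =>
    H.continuous.comp ((continuous_projIcc (h := zero_le_one (α := ℝ))).prodMk continuous_const)
  -- The conjugator at `y` is the monodromy along the track of `y` under the homotopy.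
  choose h hh using fun y => S.exists_transports c (hc y)
  refine ⟨h, fun γ hγ a b ha hb => ?_⟩
  have hR : Continuous fun p : ℝ × ℝ => H (projIcc (0 : ℝ) 1 zero_le_one p.1, γ p.2) :=
    H.continuous.comp (((continuous_projIcc (h := zero_le_one (α := ℝ))).comp continuous_fst).prodMk
      (hγ.comp continuous_snd))
  refine S.transports_square c hR ?_ ?_ (hh (γ 0)) (hh (γ 1))
  · refine ha.congr fun t _ => ?_
    simp
  · refine hb.congr fun t _ => ?_
    simp

end ArcDecomp

/-! ### Collapsed arcs and the valences of the quotient -/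

namespace ArcDecomp

variable {X : Type u} [TopologicalSpace X] {E : Type v} (S : ArcDecomp X E)

/-- Arcs collapsed by a homotopy equivalence form a forest: they are fewer than their ends. -/
theorem card_lt_of_collapsed [T2Space X] [Finite E] {Y : Type*} [TopologicalSpace Y]
    {q : C(X, Y)} (hq : IsHomotopyEquivMap q) {B : Finset E}
    (hB : ∀ e ∈ B, ∀ t ∈ Icc (0 : ℝ) 1, q (S.arc e t) = q (S.arc e 0)) {W : Finset X}
    (hW : W.Nonempty) (hBW : ∀ e ∈ B, S.arc e 0 ∈ W ∧ S.arc e 1 ∈ W) : B.card < W.card := by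
  classical
  obtain ⟨Q, rfl⟩ := hq
  let F := Multiplicative (ZMod 2)
  -- The coboundary of the graph formed by `W` and `B`, mod 2. It is surjective by the homotopy
  -- equivalence but not injective, which bounds |B| by counting.
  let Φ : (W → F) → (B → F) := fun u e =>
    (u ⟨_, (hBW e e.2).1⟩)⁻¹ * u ⟨_, (hBW e e.2).2⟩
  -- Extend `d` by the trivial label. The homotopy from `Q.invFun ∘ Q.toFun` to the identity
  -- compares monodromy 1 on a collapsed arc with its label, so the conjugator has coboundary `d`.
  have hsurj : Function.Surjective Φ := by
    intro d
    let c : E → F := fun e => if h : e ∈ B then d ⟨e, h⟩ else 1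
    obtain ⟨h, hh⟩ := S.exists_conj_of_homotopic c Q.left_inv
    refine ⟨fun x => h x, funext fun e => ?_⟩
    have hc : c e = d e := dif_pos e.2
    have := hh (S.arc e) (S.continuous_arc e) 1 (c e)
      (S.transports_const c fun t ht => congrArg Q.invFun (hB e e.2 t ht)) (S.transports_arc c e)
    rw [one_mul] at this
    simp only [Φ, ← hc, ← this]
    rw [inv_mul_cancel_left]
  by_contra! hle
  have hF : Fintype.card F = 2 := ZMod.card 2
  have hcard : Fintype.card (W → F) ≤ Fintype.card (B → F) := by
    rw [Fintype.card_fun, Fintype.card_fun, hF, Fintype.card_coe, Fintype.card_coe]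
    exact Nat.pow_le_pow_right two_pos hle
  have hinj : Function.Injective Φ :=
    ((Fintype.bijective_iff_surjective_and_card Φ).2
      ⟨hsurj, hcard.antisymm (Fintype.card_le_of_surjective Φ hsurj)⟩).1
  -- Both constant functions have trivial coboundary, so injectivity would identify them.
  have h01 : (fun _ => 1 : W → F) = fun _ => Multiplicative.ofAdd (1 : ZMod 2) :=
    hinj (funext fun e => (inv_mul_cancel _).trans (inv_mul_cancel _).symm)
  obtain ⟨w, hw⟩ := hW
  have := congrFun h01 ⟨w, hw⟩
  exact absurd this (by decide)

open Classical in
/-- At least three ends of arcs leave a forest. -/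
lemma three_le_sum_ends [Fintype E] {W : Finset X} (h3 : ∀ x ∈ W, 3 ≤ S.deg x)
    {B : Finset E} (hBW : ∀ e ∈ B, S.arc e 0 ∈ W ∧ S.arc e 1 ∈ W) (hlt : B.card < W.card) :
    3 ≤ ∑ e ∈ Bᶜ, ((if S.arc e 0 ∈ W then 1 else 0) + (if S.arc e 1 ∈ W then 1 else 0)) := by
  have h1 : ∑ x ∈ W, S.deg x =
      ∑ e, ((if S.arc e 0 ∈ W then 1 else 0) + (if S.arc e 1 ∈ W then 1 else 0)) := by
    simp only [deg]
    rw [Finset.sum_comm]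
    refine Finset.sum_congr rfl fun e _ => ?_
    rw [Finset.sum_add_distrib, Finset.sum_ite_eq, Finset.sum_ite_eq]
  have h2 : W.card * 3 ≤ ∑ x ∈ W, S.deg x := by
    rw [← smul_eq_mul]
    exact Finset.card_nsmul_le_sum _ _ _ h3
  have h3 : ∑ e ∈ B, ((if S.arc e 0 ∈ W then 1 else 0) + (if S.arc e 1 ∈ W then 1 else 0)) =
      B.card * 2 := by
    rw [← smul_eq_mul, ← Finset.sum_const]
    refine Finset.sum_congr rfl fun e he => ?_
    rw [if_pos (hBW e he).1, if_pos (hBW e he).2]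
  have h4 := Finset.sum_add_sum_compl B fun e =>
    (if S.arc e 0 ∈ W then 1 else 0) + (if S.arc e 1 ∈ W then 1 else 0)
  -- The remaining ends number at least 3|W| - 2|B| ≥ |W| + 2 ≥ 3.
  omega

/-- The map `q` collapses the arcs outside of `A` and is injective away from them. -/
structure IsArcCollapse {Y : Type*} (q : X → Y) (A : Set E) : Prop where
  surjective : Function.Surjective q
  const : ∀ e ∉ A, ∀ t ∈ Icc (0 : ℝ) 1, q (S.arc e t) = q (S.arc e 0)
  inj : ∀ e ∈ A, ∀ t ∈ Ioo (0 : ℝ) 1, ∀ x, q x = q (S.arc e t) → x = S.arc e t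

namespace IsArcCollapse

variable {S} {Y : Type*} [TopologicalSpace Y] {q : C(X, Y)} {A : Set E}

open Classical in
/-- The decomposition of the target of a collapse. -/
noncomputable def push (h : S.IsArcCollapse q A) : ArcDecomp Y A where
  vertices := S.vertices.image q
  arc e t := q (S.arc e t)
  continuous_arc e := q.continuous.comp (S.continuous_arc e)
  zero_mem e := Finset.mem_image_of_mem _ (S.zero_mem e)
  one_mem e := Finset.mem_image_of_mem _ (S.one_mem e)
  notMem e t ht hmem := by
    obtain ⟨x, hx, hxt⟩ := Finset.mem_image.1 hmem
    exact S.notMem e t ht (h.inj e e.2 t ht x hxt ▸ hx)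
  inj e e' t t' ht ht' heq := by
    obtain ⟨h1, h2⟩ := S.inj e e' t t' ht ht' (h.inj e' e'.2 t' ht' _ heq)
    exact ⟨Subtype.ext h1, h2⟩
  cover y := by
    obtain ⟨x, rfl⟩ := h.surjective y
    rcases S.cover x with hx | ⟨e, t, ht, rfl⟩
    · exact .inl (Finset.mem_image_of_mem _ hx)
    by_cases he : e ∈ A
    · exact .inr ⟨⟨e, he⟩, t, ht, rfl⟩
    · left
      rw [h.const e he t (Ioo_subset_Icc_self ht)]
      exact Finset.mem_image_of_mem _ (S.zero_mem e)

open Classical in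
/-- At least three ends of uncollapsed arcs lie in each fibre over a vertex of the target. -/
lemma three_le_push_deg [T2Space X] [Fintype E] (h : S.IsArcCollapse q A)
    (hq : IsHomotopyEquivMap q) (h3 : ∀ x ∈ S.vertices, 3 ≤ S.deg x) {y : Y}
    (hy : y ∈ h.push.vertices) : 3 ≤ h.push.deg y := by
  set W := S.vertices.filter fun x => q x = y with hWdef
  have hW : W.Nonempty := by
    obtain ⟨x, hx, hxy⟩ := Finset.mem_image.1 hy
    exact ⟨x, Finset.mem_filter.2 ⟨hx, hxy⟩⟩
  set B := Finset.univ.filter fun e => e ∉ A ∧ S.arc e 0 ∈ W with hBdef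
  have hBW : ∀ e ∈ B, S.arc e 0 ∈ W ∧ S.arc e 1 ∈ W := by
    intro e he
    obtain ⟨-, heA, he0⟩ := Finset.mem_filter.1 he
    refine ⟨he0, Finset.mem_filter.2 ⟨S.one_mem e, ?_⟩⟩
    rw [h.const e heA 1 (by simp)]
    exact (Finset.mem_filter.1 he0).2
  have hlt := S.card_lt_of_collapsed hq
    (fun e he => h.const e (Finset.mem_filter.1 he).2.1) hW hBW
  refine (S.three_le_sum_ends (fun x hx => h3 x (Finset.mem_filter.1 hx).1) hBW hlt).trans ?_
  have hsum : h.push.deg y = ∑ e ∈ Finset.univ.filter (· ∈ A),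
      ((if S.arc e 0 ∈ W then 1 else 0) + (if S.arc e 1 ∈ W then 1 else 0)) := by
    rw [Finset.sum_subtype (p := (· ∈ A)) _ (by simp)]
    refine Finset.sum_congr rfl fun e _ => ?_
    simp only [push, hWdef, Finset.mem_filter, S.zero_mem, S.one_mem, true_and]
    congr!
  rw [hsum]
  -- A collapsed arc with one end in the fibre has both there and lies in `B`; hence every
  -- contributing arc outside `B` survives.
  refine Finset.sum_le_sum_of_ne_zero fun e he hne => ?_
  rw [Finset.mem_compl] at he
  rw [Finset.mem_filter]
  refine ⟨Finset.mem_univ _, ?_⟩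
  by_contra heA
  have he0 : S.arc e 0 ∉ W := fun h0 => he (Finset.mem_filter.2 ⟨Finset.mem_univ _, heA, h0⟩)
  have he1 : S.arc e 1 ∉ W := by
    intro h1
    refine he0 (Finset.mem_filter.2 ⟨S.zero_mem e, ?_⟩)
    rw [← h.const e heA 1 (by simp)]
    exact (Finset.mem_filter.1 h1).2
  rw [if_neg he0, if_neg he1] at hne
  exact hne rfl

/-- Every vertex lies in the same fibre as an end of an uncollapsed arc. -/
lemma exists_end_eq [T2Space X] [Fintype E] (h : S.IsArcCollapse q A)
    (hq : IsHomotopyEquivMap q) (h3 : ∀ x ∈ S.vertices, 3 ≤ S.deg x) {x : X}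
    (hx : x ∈ S.vertices) : ∃ e ∈ A, q (S.arc e 0) = q x ∨ q (S.arc e 1) = q x := by
  classical
  have hdeg := h.three_le_push_deg hq h3 (Finset.mem_image_of_mem q hx)
  by_contra! hne
  have : h.push.deg (q x) = 0 := by
    rw [deg, Finset.sum_eq_zero_iff]
    rintro ⟨e, he⟩ -
    simp [push, hne e he]
  omega

end IsArcCollapse

end ArcDecomp

/-! ### Rigidity of labellings by free generators -/

section FreeGroup

variable {α : Type*}

lemma FreeGroup.isReduced_of_length_le_one {L : List (α × Bool)} (h : L.length ≤ 1) :
    FreeGroup.IsReduced L := by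
  match L, h with
  | [], _ => exact FreeGroup.IsReduced.nil
  | [_], _ => exact FreeGroup.IsReduced.singleton

/-- Multiplying a reduced word on both sides by letters that do not cancel. -/
lemma FreeGroup.norm_inv_mul_mul [DecidableEq α] {L u v : List (α × Bool)}
    (hL : FreeGroup.IsReduced L) (hne : L ≠ []) (hu : u.length ≤ 1) (hv : v.length ≤ 1)
    (hu' : u ≠ [L.head hne]) (hv' : v ≠ [((L.getLast hne).1, !(L.getLast hne).2)]) :
    FreeGroup.norm ((FreeGroup.mk u)⁻¹ * FreeGroup.mk L * FreeGroup.mk v) =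
      u.length + L.length + v.length := by
  have h1 : FreeGroup.IsReduced (FreeGroup.invRev u ++ L) := by
    match u, hu with
    | [], _ => simpa using hL
    | [x], _ =>
      obtain ⟨a, L', rfl⟩ := List.exists_cons_of_ne_nil hne
      simp only [FreeGroup.invRev, List.map_cons, List.map_nil, List.reverse_singleton,
        List.singleton_append, FreeGroup.isReduced_cons_cons]
      refine ⟨fun h => ?_, hL⟩
      by_contra h'
      apply hu'
      rw [List.head_cons, List.singleton_inj]
      exact Prod.ext h (by revert h'; cases x.2 <;> cases a.2 <;> simp)
  have h2 : FreeGroup.IsReduced (L ++ v) := by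
    match v, hv with
    | [], _ => simpa using hL
    | [x], _ =>
      rw [FreeGroup.IsReduced, List.isChain_append]
      refine ⟨hL, FreeGroup.IsReduced.singleton, ?_⟩
      intro z hz y hy h
      rw [List.getLast?_eq_some_getLast hne, Option.mem_def, Option.some_inj] at hz
      simp only [List.head?_cons, Option.mem_def, Option.some_inj] at hy
      subst hy hz
      by_contra h'
      apply hv'
      rw [List.singleton_inj]
      exact Prod.ext h.symm (by revert h'; cases x.2 <;> cases (L.getLast hne).2 <;> simp)
  -- Cancellation can only occur at the two junctions, which are separated because `L` is nonempty.
  have h3 : FreeGroup.IsReduced (FreeGroup.invRev u ++ L ++ v) := h1.append_overlap h2 hne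
  rw [FreeGroup.inv_mk, FreeGroup.mul_mk, FreeGroup.mul_mk, FreeGroup.norm, FreeGroup.toWord_mk,
    h3.reduce_eq, List.length_append, List.length_append, FreeGroup.invRev_length]

end FreeGroup

namespace ArcDecomp

variable {X : Type u} [TopologicalSpace X] {E : Type v} (S : ArcDecomp X E) {E' : Type w}

open Classical in
lemma three_le_card_darts [Fintype E] {W : Finset X} (h3 : ∀ x ∈ W, 3 ≤ S.deg x)
    {B : Finset E} (hBW : ∀ e ∈ B, S.arc e 0 ∈ W ∧ S.arc e 1 ∈ W) (hlt : B.card < W.card) :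
    3 ≤ (Finset.univ.filter fun d : E × Bool => d.1 ∉ B ∧ S.dart d 0 ∈ W).card := by
  refine (S.three_le_sum_ends h3 hBW hlt).trans_eq ?_
  rw [Finset.card_filter, Fintype.sum_prod_type, ← Finset.sum_filter_add_sum_filter_not
    Finset.univ (fun e => e ∈ Bᶜ), Finset.filter_mem_eq_inter, Finset.univ_inter,
    Finset.sum_eq_zero (s := Finset.univ.filter fun e => e ∉ Bᶜ), add_zero]
  · refine Finset.sum_congr rfl fun e he => ?_
    rw [Finset.mem_compl] at he
    rw [Fintype.sum_bool]
    simp [dart, he, add_comm]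
  · intro e he
    simp only [Finset.mem_filter, Finset.mem_compl, not_not] at he
    simp [he.2]

open Classical in
/-- The word read along a dart by a map sending the arcs `e ∈ A` to the letters `θ e`, with
orientations `b e`, and collapsing the other arcs. -/
noncomputable def letterWord (A : Set E) (θ : E → E') (b : E → Bool) (d : E × Bool) :
    List (E' × Bool) :=
  if d.1 ∈ A then [(θ d.1, xor d.2 (b d.1))] else []

lemma length_letterWord_le (A : Set E) (θ : E → E') (b : E → Bool) (d : E × Bool) :
    (letterWord A θ b d).length ≤ 1 := by
  unfold letterWord
  split_ifs <;> simp

lemma mk_letterWord_true (A : Set E) (θ : E → E') (b : E → Bool) (e : E) :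
    FreeGroup.mk (letterWord A θ b (e, true)) = (FreeGroup.mk (letterWord A θ b (e, false)))⁻¹ := by
  rw [FreeGroup.inv_mk]
  unfold letterWord
  split_ifs <;> simp [FreeGroup.invRev]

/-- The letter determines the arc by injectivity of `θ`, and its sign then determines the direction.
So at most one dart can cancel a given end of the conjugator. -/
lemma letterWord_inj {A : Set E} {θ : E → E'} (hθ : InjOn θ A) (b : E → Bool) {d d' : E × Bool}
    {l : E' × Bool} (hd : letterWord A θ b d = [l]) (hd' : letterWord A θ b d' = [l]) : d = d' := by
  unfold letterWord at hd hd'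
  split_ifs at hd hd' with h h'
  rw [← hd] at hd'
  simp only [List.cons.injEq, Prod.mk.injEq, and_true] at hd'
  obtain ⟨e, c⟩ := d
  obtain ⟨e', c'⟩ := d'
  obtain rfl : e' = e := hθ h' h hd'.1
  simp only [Bool.xor_left_inj] at hd'
  simp [hd'.2]

/-- If two labellings of a graph by letters are conjugate, then they are equal: a vertex at which
the conjugator is longest would be the origin of at most two darts. -/
theorem letterWord_eq_of_conj [T2Space X] [Fintype E] (h3 : ∀ x ∈ S.vertices, 3 ≤ S.deg x)
    {A₁ A₂ : Set E} {θ₁ θ₂ : E → E'} (hθ₁ : InjOn θ₁ A₁) (hθ₂ : InjOn θ₂ A₂) (b₁ b₂ : E → Bool)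
    (hforest : ∀ (B : Finset E) (W : Finset X), (∀ e ∈ B, e ∉ A₁) → W.Nonempty →
      (∀ e ∈ B, S.arc e 0 ∈ W ∧ S.arc e 1 ∈ W) → B.card < W.card)
    (h : X → FreeGroup E') (hh : ∀ e,
      h (S.arc e 0) * FreeGroup.mk (letterWord A₂ θ₂ b₂ (e, false)) =
        FreeGroup.mk (letterWord A₁ θ₁ b₁ (e, false)) * h (S.arc e 1)) (e : E) :
    letterWord A₁ θ₁ b₁ (e, false) = letterWord A₂ θ₂ b₂ (e, false) := by
  classical
  have hdart : ∀ d, h (S.dart d 1) = (FreeGroup.mk (letterWord A₁ θ₁ b₁ d))⁻¹ * h (S.dart d 0) *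
      FreeGroup.mk (letterWord A₂ θ₂ b₂ d) := by
    rintro ⟨e, _ | _⟩
    · simp only [dart, cond_false]
      rw [mul_assoc, hh, inv_mul_cancel_left]
    · simp only [dart, cond_true, sub_zero, sub_self]
      rw [mk_letterWord_true, mk_letterWord_true, inv_inv, ← hh, mul_inv_cancel_right]
  have hdart_mem : ∀ d t, t = 0 ∨ t = 1 → S.dart d t ∈ S.vertices := by
    rintro ⟨e, _ | _⟩ t (rfl | rfl) <;> simp [dart, S.zero_mem, S.one_mem]
  have hone : ∀ x ∈ S.vertices, h x = 1 := by
    by_contra! hex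
    obtain ⟨x₁, hx₁, hne₁⟩ := hex
    obtain ⟨x₀, hx₀, hmax⟩ := S.vertices.exists_max_image (fun x => (h x).norm) ⟨x₁, hx₁⟩
    have hne : h x₀ ≠ 1 := by
      intro h0
      have := hmax x₁ hx₁
      rw [h0, FreeGroup.norm_one, Nat.le_zero, FreeGroup.norm_eq_zero] at this
      exact hne₁ this
    set L := (h x₀).toWord with hL
    have hLne : L ≠ [] := fun hnil => hne (FreeGroup.toWord_eq_nil_iff.1 hnil)
    have hLred : FreeGroup.IsReduced L := FreeGroup.isReduced_toWord
    have hmk : FreeGroup.mk L = h x₀ := FreeGroup.mk_toWord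
    set W := S.vertices.filter fun x => h x = h x₀ with hW
    -- The conjugator is constant along arcs collapsed by both maps, so such arcs do not leave `W`;
    -- they must be discarded before counting darts that change its length.
    set B := Finset.univ.filter fun e => e ∉ A₁ ∧ e ∉ A₂ ∧ S.arc e 0 ∈ W with hB
    have hends : ∀ e, e ∉ A₁ → e ∉ A₂ → (S.arc e 0 ∈ W ↔ S.arc e 1 ∈ W) := by
      intro e h1 h2
      have := hh e
      simp only [letterWord, if_neg h1, if_neg h2] at this
      rw [← FreeGroup.one_eq_mk, one_mul, mul_one] at this
      simp only [hW, Finset.mem_filter, S.zero_mem, S.one_mem, true_and, this]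
    have hBW : ∀ e ∈ B, S.arc e 0 ∈ W ∧ S.arc e 1 ∈ W := by
      intro e he
      obtain ⟨-, h1, h2, h0⟩ := Finset.mem_filter.1 he
      exact ⟨h0, (hends e h1 h2).1 h0⟩
    have hlt := hforest B W (fun e he => (Finset.mem_filter.1 he).2.1)
      ⟨x₀, Finset.mem_filter.2 ⟨hx₀, rfl⟩⟩ hBW
    set D := Finset.univ.filter fun d : E × Bool => d.1 ∉ B ∧ S.dart d 0 ∈ W with hD
    have hDcard : 3 ≤ D.card := by
      convert S.three_le_card_darts (fun x hx => h3 x (Finset.mem_filter.1 hx).1) hBW hlt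
    set a := L.head hLne
    set z : E' × Bool := ((L.getLast hLne).1, !(L.getLast hLne).2)
    -- A dart that cancels neither the first nor the last letter adds both word lengths to the norm.
    -- Maximality forces both words to be empty, which would put its arc in `B`.
    have hDsub : D ⊆ (Finset.univ.filter fun d => letterWord A₁ θ₁ b₁ d = [a]) ∪
        Finset.univ.filter fun d => letterWord A₂ θ₂ b₂ d = [z] := by
      intro d hd
      obtain ⟨-, hdB, hdW⟩ := Finset.mem_filter.1 hd
      by_contra hnot
      simp only [Finset.mem_union, Finset.mem_filter, Finset.mem_univ, true_and, not_or] at hnot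
      have hnorm := FreeGroup.norm_inv_mul_mul hLred hLne (length_letterWord_le A₁ θ₁ b₁ d)
        (length_letterWord_le A₂ θ₂ b₂ d) hnot.1 hnot.2
      rw [hmk, ← (Finset.mem_filter.1 hdW).2, ← hdart] at hnorm
      have hle := hmax _ (hdart_mem d 1 (.inr rfl))
      rw [hnorm, FreeGroup.norm, ← hL] at hle
      have hA₁ : d.1 ∉ A₁ := by
        intro hA
        simp only [letterWord, if_pos hA, List.length_singleton] at hle
        omega
      have hA₂ : d.1 ∉ A₂ := by
        intro hA
        simp only [letterWord, if_pos hA, List.length_singleton] at hle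
        omega
      refine hdB (Finset.mem_filter.2 ⟨Finset.mem_univ _, hA₁, hA₂, ?_⟩)
      obtain ⟨e, _ | _⟩ := d
      · simpa [dart] using hdW
      · exact (hends e hA₁ hA₂).2 (by simpa [dart] using hdW)
    have hc₁ : (Finset.univ.filter fun d => letterWord A₁ θ₁ b₁ d = [a]).card ≤ 1 :=
      Finset.card_le_one.2 fun d hd d' hd' =>
        letterWord_inj hθ₁ b₁ (Finset.mem_filter.1 hd).2 (Finset.mem_filter.1 hd').2
    have hc₂ : (Finset.univ.filter fun d => letterWord A₂ θ₂ b₂ d = [z]).card ≤ 1 :=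
      Finset.card_le_one.2 fun d hd d' hd' =>
        letterWord_inj hθ₂ b₂ (Finset.mem_filter.1 hd).2 (Finset.mem_filter.1 hd').2
    have := (Finset.card_le_card hDsub).trans (Finset.card_union_le _ _)
    omega
  have he := hh e
  rw [hone _ (S.zero_mem e), hone _ (S.one_mem e), one_mul, mul_one] at he
  have := congrArg FreeGroup.toWord he
  rw [FreeGroup.toWord_mk, FreeGroup.toWord_mk,
    (FreeGroup.isReduced_of_length_le_one (length_letterWord_le _ _ _ _)).reduce_eq,
    (FreeGroup.isReduced_of_length_le_one (length_letterWord_le _ _ _ _)).reduce_eq] at this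
  exact this.symm

end ArcDecomp

/-! ### Reparametrizations isotopic to the identity -/

/-- The straight line from the identity to an order automorphism of the real line. -/
noncomputable def OrderIso.line (τ : ℝ ≃o ℝ) (s : unitInterval) : ℝ ≃o ℝ :=
  StrictMono.orderIsoOfSurjective (fun t => (1 - (s : ℝ)) * t + s * τ t)
    (by
      intro a b hab
      have h1 := τ.strictMono hab
      rcases s.2.1.eq_or_lt with h | h
      · simp only [← h]; linarith
      · exact add_lt_add_of_le_of_lt
          (mul_le_mul_of_nonneg_left hab.le (sub_nonneg.2 s.2.2)) (mul_lt_mul_of_pos_left h1 h))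
    (by
      have hc : Continuous fun t => (1 - (s : ℝ)) * t + s * τ t := by
        have := τ.continuous
        fun_prop
      intro y
      have h0 : 0 ≤ 1 - (s : ℝ) := sub_nonneg.2 s.2.2
      -- At the minimum both `t` and `τ t` are at most `y`, at the maximum both are at least `y`,
      -- and the same holds for their convex combinations.
      refine mem_range_of_exists_le_of_exists_ge hc ⟨min y (τ.symm y), ?_⟩ ⟨max y (τ.symm y), ?_⟩
      · have h1 : τ (min y (τ.symm y)) ≤ y := by
          rw [← τ.le_symm_apply]; exact min_le_right _ _
        nlinarith [mul_le_mul_of_nonneg_left h1 s.2.1,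
          mul_le_mul_of_nonneg_left (min_le_left y (τ.symm y)) h0]
      · have h1 : y ≤ τ (max y (τ.symm y)) := by
          rw [← τ.symm_apply_le]; exact le_max_right _ _
        nlinarith [mul_le_mul_of_nonneg_left h1 s.2.1,
          mul_le_mul_of_nonneg_left (le_max_left y (τ.symm y)) h0])

lemma OrderIso.line_apply (τ : ℝ ≃o ℝ) (s : unitInterval) (t : ℝ) :
    τ.line s t = (1 - (s : ℝ)) * t + s * τ t := rfl

namespace ArcDecomp

variable {X : Type u} [TopologicalSpace X] {E : Type v} (S : ArcDecomp X E)

open Classical in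
/-- Reparametrize each arc. -/
noncomputable def reparam (τ : E → ℝ ≃o ℝ) (x : X) : X :=
  if h : ∃ e, x ∈ S.openArc e then S.arc h.choose (τ h.choose (S.arcInv h.choose x)) else x

lemma reparam_of_mem_vertices (τ : E → ℝ ≃o ℝ) {x : X} (hx : x ∈ S.vertices) :
    S.reparam τ x = x := by
  rw [reparam, dif_neg]
  rintro ⟨e, he⟩
  exact S.notMem_of_mem_openArc he hx

lemma reparam_arc {τ : E → ℝ ≃o ℝ} (h0 : ∀ e, τ e 0 = 0) (h1 : ∀ e, τ e 1 = 1) (e : E) {t : ℝ}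
    (ht : t ∈ Icc (0 : ℝ) 1) : S.reparam τ (S.arc e t) = S.arc e (τ e t) := by
  rcases mem_Icc_cases ht with rfl | rfl | ht
  · rw [S.reparam_of_mem_vertices τ (S.zero_mem e), h0]
  · rw [S.reparam_of_mem_vertices τ (S.one_mem e), h1]
  · have h : ∃ e', S.arc e t ∈ S.openArc e' := ⟨e, t, ht, rfl⟩
    have he : h.choose = e := S.eq_of_mem_openArc h.choose_spec ⟨t, ht, rfl⟩
    rw [reparam, dif_pos h, he, S.arcInv_arc ht]

lemma orderIso_mem_Icc {τ : ℝ ≃o ℝ} (h0 : τ 0 = 0) (h1 : τ 1 = 1) {t : ℝ}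
    (ht : t ∈ Icc (0 : ℝ) 1) : τ t ∈ Icc (0 : ℝ) 1 :=
  ⟨h0 ▸ τ.monotone ht.1, h1 ▸ τ.monotone ht.2⟩

lemma mem_cases (x : X) : x ∈ S.vertices ∨ ∃ e, ∃ t ∈ Icc (0 : ℝ) 1, S.arc e t = x := by
  rcases S.cover x with h | ⟨e, t, ht, h⟩
  exacts [.inl h, .inr ⟨e, t, Ioo_subset_Icc_self ht, h⟩]

lemma reparam_symm_reparam {τ : E → ℝ ≃o ℝ} (h0 : ∀ e, τ e 0 = 0) (h1 : ∀ e, τ e 1 = 1) (x : X) :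
    S.reparam (fun e => (τ e).symm) (S.reparam τ x) = x := by
  rcases S.mem_cases x with h | ⟨e, t, ht, rfl⟩
  · rw [S.reparam_of_mem_vertices _ h, S.reparam_of_mem_vertices _ h]
  · have h0' : ∀ e, (τ e).symm 0 = 0 := fun e => by rw [OrderIso.symm_apply_eq, h0]
    have h1' : ∀ e, (τ e).symm 1 = 1 := fun e => by rw [OrderIso.symm_apply_eq, h1]
    rw [S.reparam_arc h0 h1 e ht, S.reparam_arc h0' h1' e (orderIso_mem_Icc (h0 e) (h1 e) ht),
      OrderIso.symm_apply_apply]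

lemma bijective_reparam {τ : E → ℝ ≃o ℝ} (h0 : ∀ e, τ e 0 = 0) (h1 : ∀ e, τ e 1 = 1) :
    Function.Bijective (S.reparam τ) := by
  have h0' : ∀ e, (τ e).symm 0 = 0 := fun e => by rw [OrderIso.symm_apply_eq, h0]
  have h1' : ∀ e, (τ e).symm 1 = 1 := fun e => by rw [OrderIso.symm_apply_eq, h1]
  refine ⟨Function.LeftInverse.injective (S.reparam_symm_reparam h0 h1),
    Function.RightInverse.surjective (g := S.reparam fun e => (τ e).symm) fun x => ?_⟩
  simpa using S.reparam_symm_reparam h0' h1' x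

/-- Continuity can be checked on arcs. -/
lemma continuous_of_arcs [T2Space X] [Finite E] (hcov : ∀ x ∈ S.vertices, ∃ e, x ∈ S.closedArc e)
    {P Y : Type*} [TopologicalSpace P] [TopologicalSpace Y] {Φ : P × X → Y}
    (h : ∀ e, Continuous fun z : P × unitInterval => Φ (z.1, S.arc e z.2)) : Continuous Φ := by
  rw [continuous_iff_isClosed]
  intro C hC
  let m : E → P × unitInterval → P × X := fun e => Prod.map id fun t : unitInterval => S.arc e t
  -- Properness of the compact arcs keeps these maps closed after taking the product with an
  -- arbitrary parameter space.
  have hm : ∀ e, IsClosedMap (m e) := fun e =>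
    (isProperMap_id.prodMap
      ((S.continuous_arc e).comp continuous_subtype_val).isProperMap).isClosedMap
  have : Φ ⁻¹' C = ⋃ e, m e '' ((fun z : P × unitInterval => Φ (z.1, S.arc e z.2)) ⁻¹' C) := by
    ext ⟨p, x⟩
    simp only [mem_iUnion]
    constructor
    · intro hx
      obtain ⟨e, t, ht, rfl⟩ : ∃ e, x ∈ S.closedArc e := by
        rcases S.mem_cases x with h | ⟨e, t, ht, rfl⟩
        exacts [hcov x h, ⟨e, t, ht, rfl⟩]
      exact ⟨e, (p, ⟨t, ht⟩), hx, rfl⟩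
    · rintro ⟨e, ⟨p', t⟩, hz, heq⟩
      simp only [m, Prod.map, id, Prod.mk.injEq] at heq
      obtain ⟨rfl, rfl⟩ := heq
      exact hz
  rw [this]
  exact isClosed_iUnion_of_finite fun e => hm e _ (hC.preimage (h e))

lemma exists_mem_closedArc [Fintype E] {x : X} (h : S.deg x ≠ 0) : ∃ e, x ∈ S.closedArc e := by
  by_contra! hne
  refine h (Finset.sum_eq_zero fun e _ => ?_)
  have h0 : S.arc e 0 ≠ x := fun h => hne e ⟨0, by simp, h⟩
  have h1 : S.arc e 1 ≠ x := fun h => hne e ⟨1, by simp, h⟩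
  simp [h0, h1]

/-- A reparametrization of the arcs is isotopic to the identity. -/
theorem exists_isotopic_reparam [T2Space X] [Finite E]
    (hcov : ∀ x ∈ S.vertices, ∃ e, x ∈ S.closedArc e) {τ : E → ℝ ≃o ℝ} (h0 : ∀ e, τ e 0 = 0)
    (h1 : ∀ e, τ e 1 = 1) : ∃ h : X ≃ₜ X, IsIsotopicToId h ∧ ∀ x, h x = S.reparam τ x := by
  have := S.compactSpace
  have hl0 : ∀ s e, (τ e).line s 0 = 0 := fun s e => by simp [OrderIso.line_apply, h0]
  have hl1 : ∀ s e, (τ e).line s 1 = 1 := fun s e => by simp [OrderIso.line_apply, h1]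
  have hcont : Continuous fun z : unitInterval × X => S.reparam (fun e => (τ e).line z.1) z.2 := by
    refine S.continuous_of_arcs hcov fun e => ?_
    have heq : (fun z : unitInterval × unitInterval =>
        S.reparam (fun e => (τ e).line z.1) (S.arc e z.2)) =
        fun z => S.arc e ((1 - (z.1 : ℝ)) * z.2 + z.1 * τ e z.2) := by
      funext z
      rw [S.reparam_arc (hl0 z.1) (hl1 z.1) e z.2.2, OrderIso.line_apply]
    rw [heq]
    have := (τ e).continuous
    exact (S.continuous_arc e).comp (by fun_prop)
  have hline0 : ∀ e, (τ e).line 0 = OrderIso.refl ℝ := fun e => by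
    ext t; simp [OrderIso.line_apply]
  have hline1 : ∀ e, (τ e).line 1 = τ e := fun e => by
    ext t; simp [OrderIso.line_apply]
  have hhomeo : ∀ s, IsHomeomorph fun x => S.reparam (fun e => (τ e).line s) x := fun s =>
    isHomeomorph_iff_continuous_bijective.2
      ⟨hcont.comp (continuous_const.prodMk continuous_id), S.bijective_reparam (hl0 s) (hl1 s)⟩
  have hτ : IsHomeomorph (S.reparam τ) := by simpa only [hline1] using hhomeo 1
  refine ⟨hτ.homeomorph _, ⟨⟨_, hcont⟩, fun x => ?_, fun x => ?_, hhomeo⟩, fun x => rfl⟩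
  · simp only [ContinuousMap.coe_mk, hline0]
    rcases S.mem_cases x with h | ⟨e, t, ht, rfl⟩
    · exact S.reparam_of_mem_vertices _ h
    · rw [S.reparam_arc (fun _ => rfl) (fun _ => rfl) e ht]
      rfl
  · simp only [ContinuousMap.coe_mk, hline1]
    rfl

end ArcDecomp

/-! ### Labels of a collapse onto a graph -/

namespace ArcDecomp

variable {X : Type u} [TopologicalSpace X] {E : Type v} (S : ArcDecomp X E)

lemma nonempty_of_deg_ne_zero [Fintype E] [Nonempty X] (h : ∀ x ∈ S.vertices, S.deg x ≠ 0) :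
    Nonempty E := by
  obtain ⟨x⟩ := ‹Nonempty X›
  rcases S.cover x with hx | ⟨e, -⟩
  · exact ⟨(S.exists_mem_closedArc (h x hx)).choose⟩
  · exact ⟨e⟩

lemma closedArc_eq_image {τ : ℝ ≃o ℝ} (h0 : τ 0 = 0) (h1 : τ 1 = 1) (b : Bool) (e : E) :
    (fun t => S.arc e (bif b then τ t else 1 - τ t)) '' Icc 0 1 = S.closedArc e := by
  have hτ : τ '' Icc 0 1 = Icc 0 1 := by rw [OrderIso.image_Icc, h0, h1]
  cases b
  · simp only [cond_false]
    rw [← image_image (fun s => S.arc e (1 - s)) τ, hτ, ← image_image (S.arc e) (fun s => 1 - s)]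
    simp [closedArc]
  · simp only [cond_true]
    rw [← image_image (S.arc e) τ, hτ, closedArc]

/-- The target arcs, orientations and parametrizations of the arcs that a collapse leaves. -/
structure Labels {Y : Type*} [TopologicalSpace Y] {E' : Type w} (T : ArcDecomp Y E') (q : X → Y)
    (A : Set E) where
  target : E → E'
  forward : E → Bool
  param : E → ℝ ≃o ℝ
  param_zero : ∀ e, param e 0 = 0
  param_one : ∀ e, param e 1 = 1
  map_arc : ∀ e ∈ A, ∀ t ∈ Icc (0 : ℝ) 1,
    q (S.arc e t) = T.arc (target e) (bif forward e then param e t else 1 - param e t)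
  injOn : InjOn target A
  surjOn : SurjOn target A univ

namespace Labels

variable {S} {Y : Type*} [TopologicalSpace Y] {E' : Type w} {T : ArcDecomp Y E'} {q : X → Y}
  {A : Set E} (l : S.Labels T q A)

include l in
lemma image_closedArc {e : E} (he : e ∈ A) : q '' S.closedArc e = T.closedArc (l.target e) := by
  rw [closedArc, image_image, ← T.closedArc_eq_image (l.param_zero e) (l.param_one e) (l.forward e)]
  exact image_congr fun t ht => l.map_arc e he t ht

lemma transports {F : Type*} [Group F] (c : E' → F) {e : E} (he : e ∈ A) :
    T.Transports c (fun t => q (S.arc e t))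
      (if l.forward e then c (l.target e) else (c (l.target e))⁻¹) := by
  have h : T.Transports c (T.arc (l.target e) ∘ l.param e) (c (l.target e)) :=
    (T.transports_arc c _).comp (l.param e).continuous
      (fun t ht => orderIso_mem_Icc (l.param_zero e) (l.param_one e) ht)
      (l.param_zero e) (l.param_one e)
  have hr : T.Transports c (fun t => T.arc (l.target e) (1 - l.param e t)) (c (l.target e))⁻¹ :=
    (T.transports_arc c _).reverse.comp (l.param e).continuous
      (fun t ht => orderIso_mem_Icc (l.param_zero e) (l.param_one e) ht)
      (l.param_zero e) (l.param_one e)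
  cases hb : l.forward e
  · simpa using hr.congr fun t ht => by rw [l.map_arc e he t ht, hb]; rfl
  · simpa using h.congr fun t ht => by rw [l.map_arc e he t ht, hb]; rfl

lemma transports_letterWord (hc : ∀ e ∉ A, ∀ t ∈ Icc (0 : ℝ) 1, q (S.arc e t) = q (S.arc e 0))
    (e : E) : T.Transports (FreeGroup.of : E' → FreeGroup E') (fun t => q (S.arc e t))
      (FreeGroup.mk (letterWord A l.target l.forward (e, false))) := by
  unfold letterWord
  split_ifs with he
  · have h := l.transports FreeGroup.of he
    cases hb : l.forward e <;> rw [hb] at h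
    · simpa [FreeGroup.of, FreeGroup.inv_mk, FreeGroup.invRev] using h
    · simpa [FreeGroup.of] using h
  · exact T.transports_const _ fun t ht => hc e he t ht

end Labels

/-- A collapse onto a graph maps each arc that it leaves homeomorphically to an arc. -/
theorem IsArcCollapse.nonempty_labels [T2Space X] [Fintype E] {S : ArcDecomp X E} {Y : Type*}
    [TopologicalSpace Y] [T2Space Y] [Nonempty Y] {E' : Type w} [Fintype E'] {q : C(X, Y)}
    {A : Set E} (h : S.IsArcCollapse q A) (hq : IsHomotopyEquivMap q)
    (h3 : ∀ x ∈ S.vertices, 3 ≤ S.deg x) (T : ArcDecomp Y E') (hT : ∀ y ∈ T.vertices, 3 ≤ T.deg y) :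
    Nonempty (S.Labels T q A) := by
  classical
  have : Nonempty E' := T.nonempty_of_deg_ne_zero fun y hy => by have := hT y hy; omega
  -- Both decompositions of the target have valences at least three, so they share vertices and
  -- hence open arcs.
  have hV : h.push.vertices = T.vertices :=
    h.push.vertices_eq_of_three_le_deg T (fun y hy => h.three_le_push_deg hq h3 hy) hT
  have key : ∀ e : E, ∃ (e' : E') (b : Bool) (τ : ℝ ≃o ℝ), τ 0 = 0 ∧ τ 1 = 1 ∧ ∀ he : e ∈ A,
      h.push.openArc ⟨e, he⟩ = T.openArc e' ∧ ∀ t ∈ Icc (0 : ℝ) 1,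
        q (S.arc e t) = T.arc e' (bif b then τ t else 1 - τ t) := by
    intro e
    by_cases he : e ∈ A
    · obtain ⟨e', he'⟩ := h.push.exists_openArc_eq T hV ⟨e, he⟩
      obtain ⟨τ, h0, h1, hτ | hτ⟩ := h.push.exists_reparam T he'
      · exact ⟨e', true, τ, h0, h1, fun _ => ⟨he', fun t ht => hτ t ht⟩⟩
      · exact ⟨e', false, τ, h0, h1, fun _ => ⟨he', fun t ht => hτ t ht⟩⟩
    · exact ⟨Classical.arbitrary E', true, OrderIso.refl ℝ, rfl, rfl, fun h => absurd h he⟩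
  choose θ b τ h0 h1 hτ using key
  refine ⟨⟨θ, b, τ, h0, h1, fun e he => (hτ e he).2, ?_, ?_⟩⟩
  · intro e he e' he' hee
    have h1 := h.push.arc_half_mem_openArc ⟨e, he⟩
    have h2 := h1
    rw [(hτ e he).1, hee, ← (hτ e' he').1] at h2
    simpa using h.push.eq_of_mem_openArc h1 h2
  · intro e' _
    obtain ⟨⟨e, he⟩, hee⟩ := T.exists_openArc_eq h.push hV.symm e'
    refine ⟨e, he, ?_⟩
    have h1 := T.arc_half_mem_openArc e'
    have h2 := h1
    rw [hee, (hτ e he).1] at h2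
    exact T.eq_of_mem_openArc h2 h1

/-- Homotopic collapses have the same labels. -/
theorem letterWord_eq_of_homotopic [T2Space X] [Fintype E] {S : ArcDecomp X E} {Y : Type*}
    [TopologicalSpace Y] [T2Space Y] {E' : Type w} [Fintype E'] {T : ArcDecomp Y E'}
    (h3 : ∀ x ∈ S.vertices, 3 ≤ S.deg x) {q₁ q₂ : C(X, Y)} (hq : q₁.Homotopic q₂)
    (hq₁ : IsHomotopyEquivMap q₁) {A₁ A₂ : Set E} (h₁ : S.IsArcCollapse q₁ A₁)
    (h₂ : S.IsArcCollapse q₂ A₂) (l₁ : S.Labels T q₁ A₁) (l₂ : S.Labels T q₂ A₂) (e : E) :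
    letterWord A₁ l₁.target l₁.forward (e, false) =
      letterWord A₂ l₂.target l₂.forward (e, false) := by
  obtain ⟨h, hh⟩ := T.exists_conj_of_homotopic (FreeGroup.of : E' → FreeGroup E') hq
  refine S.letterWord_eq_of_conj h3 l₁.injOn l₂.injOn _ _ ?_ h (fun e => ?_) e
  · exact fun B W hB hW hBW => S.card_lt_of_collapsed hq₁ (fun e he => h₁.const e (hB e he)) hW hBW
  · exact hh (S.arc e) (S.continuous_arc e) _ _ (l₁.transports_letterWord h₁.const e)
      (l₂.transports_letterWord h₂.const e)

end ArcDecomp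

/-! ### Forest collapses as arc collapses -/

section ForestCollapse

variable {n : ℕ} {G : MarkedGraph.{u} n} {G' : MarkedGraph.{v} n} {q : C(G.carrier, G'.carrier)}
  {H K : Set G.carrier}

namespace IsForestCollapseWith

lemma eq_of_notMem (h : IsForestCollapseWith G G' q H K) {x y : G.carrier} (hx : x ∉ K)
    (hxy : q y = q x) : y = x := by
  rcases h.fiber (q x) with ⟨z, -, hfib⟩ | ⟨z, -, hfib⟩
  · have h1 : x ∈ q ⁻¹' {q x} := rfl
    have h2 : y ∈ q ⁻¹' {q x} := hxy
    rw [hfib] at h1 h2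
    rw [h1, h2]
  · have h1 : x ∈ q ⁻¹' {q x} := rfl
    rw [hfib] at h1
    exact absurd (connectedComponentIn_subset _ _ h1) hx

lemma preimage_eq_of_mem (h : IsForestCollapseWith G G' q H K) {x : G.carrier} (hx : x ∈ K) :
    q ⁻¹' {q x} = connectedComponentIn K x := by
  have h1 : x ∈ q ⁻¹' {q x} := rfl
  rcases h.fiber (q x) with ⟨z, hz, hfib⟩ | ⟨z, -, hfib⟩
  · rw [hfib] at h1
    exact absurd (h1 ▸ hx) hz
  · rw [hfib] at h1 ⊢
    exact connectedComponentIn_eq h1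

/-- Collapses of the same forest have the same fibres. -/
lemma map_eq_of_map_eq (h : IsForestCollapseWith G G' q H K) {q' : C(G.carrier, G'.carrier)}
    {H' : Set G.carrier} (h' : IsForestCollapseWith G G' q' H' K) {x y : G.carrier}
    (hxy : q y = q x) : q' y = q' x := by
  by_cases hx : x ∈ K
  · have hy : y ∈ q ⁻¹' {q x} := hxy
    rw [h.preimage_eq_of_mem hx, ← h'.preimage_eq_of_mem hx] at hy
    exact hy
  · rw [h.eq_of_notMem hx hxy]

/-- Precompose the two marking homotopies with a homotopy inverse of the marking of the source. -/
lemma homotopic (h : IsForestCollapseWith G G' q H K) {q' : C(G.carrier, G'.carrier)}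
    {H' K' : Set G.carrier} (h' : IsForestCollapseWith G G' q' H' K') : q.Homotopic q' := by
  obtain ⟨Q, hQ⟩ := G.isHomotopyEquiv_marking
  have h1 : (q.comp G.marking).Homotopic (q'.comp G.marking) :=
    h.preservesMarking.trans h'.preservesMarking.symm
  have h2 : ∀ f : C(G.carrier, G'.carrier), ((f.comp G.marking).comp Q.invFun).Homotopic f := by
    intro f
    rw [ContinuousMap.comp_assoc, ← hQ]
    simpa using (ContinuousMap.Homotopic.refl f).comp Q.right_inv
  exact ((h2 q).symm.trans (h1.comp (ContinuousMap.Homotopic.refl Q.invFun))).trans (h2 q')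

variable {E : Type w} [Fintype E] {S : ArcDecomp G.carrier E}

/-- The arcs in a subgraph. -/
def _root_.ArcDecomp.arcsIn {X : Type u} [TopologicalSpace X] {E : Type w} (S : ArcDecomp X E)
    (H : Set X) : Set E :=
  {e | S.closedArc e ⊆ H}

lemma eq_iUnion_arcsIn (h : IsForestCollapseWith G G' q H K)
    (hS : naturalVertices G.carrier = S.vertices) : H = ⋃ e ∈ S.arcsIn H, S.closedArc e := by
  apply subset_antisymm
  · obtain ⟨T, hT, hHT⟩ := h.concrete.1
    intro x hx
    rw [hHT] at hx
    obtain ⟨c, hc, hxc⟩ := hx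
    obtain ⟨e, rfl⟩ := S.naturalEdges_eq hS ▸ hT hc
    exact mem_iUnion₂.2 ⟨e, hHT ▸ subset_sUnion_of_mem hc, hxc⟩
  · exact iUnion₂_subset fun e he => he

lemma mem_arcsIn_of_mem_openArc (h : IsForestCollapseWith G G' q H K)
    (hS : naturalVertices G.carrier = S.vertices) {e : E} {x : G.carrier} (hx : x ∈ S.openArc e)
    (hxH : x ∈ H) : e ∈ S.arcsIn H := by
  rw [h.eq_iUnion_arcsIn hS] at hxH
  obtain ⟨e', he', hxe'⟩ := mem_iUnion₂.1 hxH
  exact S.eq_of_mem_openArc_of_mem_closedArc hx hxe' ▸ he'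

/-- An open arc not contained in `H` misses `H`, so its closure lies in `K`. Conversely, since no
vertex is isolated, a point outside `H` lies on a closed arc not contained in `H`. -/
lemma forest_eq (h : IsForestCollapseWith G G' q H K)
    (hS : naturalVertices G.carrier = S.vertices) (h3 : ∀ x ∈ S.vertices, 3 ≤ S.deg x) :
    K = ⋃ e ∈ (S.arcsIn H)ᶜ, S.closedArc e := by
  rw [h.compl_eq, graphCompl]
  apply subset_antisymm
  · refine closure_minimal (fun x hx => ?_) (S.isClosed_iUnion_closedArc _)
    obtain ⟨e, he⟩ : ∃ e, x ∈ S.closedArc e := by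
      rcases S.mem_cases x with h | ⟨e, t, ht, rfl⟩
      · exact S.exists_mem_closedArc (by have := h3 x h; omega)
      · exact ⟨e, t, ht, rfl⟩
    exact mem_iUnion₂.2 ⟨e, fun heH => hx (heH he), he⟩
  · refine iUnion₂_subset fun e he => ?_
    rw [← S.closure_openArc]
    exact closure_mono fun x hx hxH => he (h.mem_arcsIn_of_mem_openArc hS hx hxH)

/-- A closed arc not contained in `H` is a connected part of `K`, hence inside one fibre. The open
arcs of `H` miss `K`, where the fibres are points. -/
lemma isArcCollapse (h : IsForestCollapseWith G G' q H K)
    (hS : naturalVertices G.carrier = S.vertices) (h3 : ∀ x ∈ S.vertices, 3 ≤ S.deg x) :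
    S.IsArcCollapse q (S.arcsIn H) where
  surjective := h.isQuotientMap.surjective
  const e he t ht := by
    have hK : S.closedArc e ⊆ K := by
      rw [h.forest_eq hS h3]
      exact subset_biUnion_of_mem (u := S.closedArc) he
    have h0 : S.arc e 0 ∈ S.closedArc e := ⟨0, by simp, rfl⟩
    have hc : IsPreconnected (S.closedArc e) :=
      isPreconnected_Icc.image _ (S.continuous_arc e).continuousOn
    have hmem : S.arc e t ∈ connectedComponentIn K (S.arc e 0) :=
      hc.subset_connectedComponentIn h0 hK ⟨t, ht, rfl⟩
    rw [← h.preimage_eq_of_mem (hK h0)] at hmem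
    exact hmem
  inj e he t ht x hx := by
    refine h.eq_of_notMem (fun hK => ?_) hx
    rw [h.forest_eq hS h3] at hK
    obtain ⟨e', he', hxe'⟩ := mem_iUnion₂.1 hK
    exact he' (S.eq_of_mem_openArc_of_mem_closedArc ⟨t, ht, rfl⟩ hxe' ▸ he)

lemma edgesIn_eq (hS : naturalVertices G.carrier = S.vertices) :
    edgesIn H = S.closedArc '' S.arcsIn H := by
  ext c
  rw [edgesIn, S.naturalEdges_eq hS]
  constructor
  · rintro ⟨⟨e, rfl⟩, he⟩
    exact ⟨e, he, rfl⟩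
  · rintro ⟨e, he, rfl⟩
    exact ⟨⟨e, rfl⟩, he⟩

end IsForestCollapseWith

end ForestCollapse

namespace ArcDecomp

variable {E : Type*} {E' : Type*}

lemma letterWord_eq_iff {A₁ A₂ : Set E} {θ₁ θ₂ : E → E'} {b₁ b₂ : E → Bool} {e : E}
    (h : letterWord A₁ θ₁ b₁ (e, false) = letterWord A₂ θ₂ b₂ (e, false)) :
    (e ∈ A₁ ↔ e ∈ A₂) ∧ (e ∈ A₁ → θ₁ e = θ₂ e ∧ b₁ e = b₂ e) := by
  unfold letterWord at h
  by_cases h1 : e ∈ A₁ <;> by_cases h2 : e ∈ A₂ <;> simp_all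

end ArcDecomp

/-! ### The assertions of the theorem -/

section ForestCollapse

variable {n : ℕ} {G : MarkedGraph.{u} n} {G' : MarkedGraph.{v} n}

/-- Two forest collapses between the same marked graphs collapse the same forest, and map the
remaining arcs to the same arcs with the same orientations. -/
theorem IsForestCollapseWith.exists_labels {E : Type u} [Fintype E] {E' : Type v} [Fintype E']
    {S : ArcDecomp G.carrier E} {T : ArcDecomp G'.carrier E'}
    (hS : naturalVertices G.carrier = S.vertices) (h3 : ∀ x ∈ S.vertices, 3 ≤ S.deg x)
    (hT : ∀ y ∈ T.vertices, 3 ≤ T.deg y)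
    {q₁ q₂ : C(G.carrier, G'.carrier)} {H₁ K₁ H₂ K₂ : Set G.carrier}
    (h₁ : IsForestCollapseWith G G' q₁ H₁ K₁) (h₂ : IsForestCollapseWith G G' q₂ H₂ K₂) :
    H₁ = H₂ ∧ K₁ = K₂ ∧ S.arcsIn H₁ = S.arcsIn H₂ ∧
      ∃ (l₁ : S.Labels T q₁ (S.arcsIn H₁)) (l₂ : S.Labels T q₂ (S.arcsIn H₂)),
        ∀ e ∈ S.arcsIn H₁, l₁.target e = l₂.target e ∧ l₁.forward e = l₂.forward e := by
  have := G'.isCore.connected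
  have hc₁ := h₁.isArcCollapse hS h3
  have hc₂ := h₂.isArcCollapse hS h3
  obtain ⟨l₁⟩ := hc₁.nonempty_labels h₁.isHomotopyEquiv h3 T hT
  obtain ⟨l₂⟩ := hc₂.nonempty_labels h₂.isHomotopyEquiv h3 T hT
  have hl := fun e => ArcDecomp.letterWord_eq_iff (ArcDecomp.letterWord_eq_of_homotopic h3
    (h₁.homotopic h₂) h₁.isHomotopyEquiv hc₁ hc₂ l₁ l₂ e)
  have hA : S.arcsIn H₁ = S.arcsIn H₂ := Set.ext fun e => (hl e).1
  have hH : H₁ = H₂ := by rw [h₁.eq_iUnion_arcsIn hS, h₂.eq_iUnion_arcsIn hS, hA]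
  exact ⟨hH, by rw [h₁.compl_eq, h₂.compl_eq, hH], hA, l₁, l₂, fun e => (hl e).2⟩

theorem IsForestCollapse.exists_isotopic (hn : 2 ≤ n) {q₁ q₂ : C(G.carrier, G'.carrier)}
    (h₁ : IsForestCollapse G G' q₁) (h₂ : IsForestCollapse G G' q₂) :
    ∃ h : G.carrier ≃ₜ G.carrier, IsIsotopicToId h ∧ ∀ x, q₂ x = q₁ (h x) := by
  classical
  obtain ⟨E, _, S, hS, h3⟩ := G.isCore.exists_natural_decomp hn
  obtain ⟨E', _, T, -, hT⟩ := G'.isCore.exists_natural_decomp hn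
  obtain ⟨H, K, h₁⟩ := h₁
  obtain ⟨H₂, K₂, h₂⟩ := h₂
  obtain ⟨rfl, rfl, -, l₁, l₂, hl⟩ := h₁.exists_labels hS h3 hT h₂
  have hc₁ := h₁.isArcCollapse hS h3
  have hc₂ := h₂.isArcCollapse hS h3
  -- Chosen so that the first parametrization after `τ` is the second; on collapsed arcs any choice
  -- fixing the endpoints works.
  let τ : E → ℝ ≃o ℝ := fun e =>
    if e ∈ S.arcsIn H then (l₂.param e).trans (l₁.param e).symm else OrderIso.refl ℝ
  have hτ : ∀ e ∈ S.arcsIn H, ∀ t, l₁.param e (τ e t) = l₂.param e t := fun e he t => by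
    simp only [τ, if_pos he, OrderIso.trans_apply, OrderIso.apply_symm_apply]
  have h0 : ∀ e, τ e 0 = 0 := by
    intro e
    by_cases he : e ∈ S.arcsIn H
    · apply (l₁.param e).injective
      rw [hτ e he, l₁.param_zero, l₂.param_zero]
    · simp only [τ, if_neg he, OrderIso.refl_apply]
  have h1 : ∀ e, τ e 1 = 1 := by
    intro e
    by_cases he : e ∈ S.arcsIn H
    · apply (l₁.param e).injective
      rw [hτ e he, l₁.param_one, l₂.param_one]
    · simp only [τ, if_neg he, OrderIso.refl_apply]
  obtain ⟨h, hiso, hh⟩ := S.exists_isotopic_reparam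
    (fun x hx => S.exists_mem_closedArc (by have := h3 x hx; omega)) h0 h1
  have harc : ∀ e ∈ S.arcsIn H, ∀ t ∈ Icc (0 : ℝ) 1, q₂ (S.arc e t) = q₁ (S.arc e (τ e t)) := by
    intro e he t ht
    rw [l₂.map_arc e he t ht, l₁.map_arc e he _ (ArcDecomp.orderIso_mem_Icc (h0 e) (h1 e) ht),
      hτ e he, (hl e he).1, (hl e he).2]
  -- Each vertex shares its fibre with an end of a surviving arc. The maps agree at that end, and
  -- their fibres coincide because the collapsed forest is the same.
  have hvert : ∀ x ∈ S.vertices, q₂ x = q₁ x := by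
    intro x hx
    obtain ⟨e, he, hx | hx⟩ := hc₁.exists_end_eq h₁.isHomotopyEquiv h3 hx
    · rw [← hx, ← h₁.map_eq_of_map_eq h₂ hx, harc e he 0 (by simp), h0]
    · rw [← hx, ← h₁.map_eq_of_map_eq h₂ hx, harc e he 1 (by simp), h1]
  refine ⟨h, hiso, fun x => ?_⟩
  rw [hh]
  rcases S.mem_cases x with hx | ⟨e, t, ht, rfl⟩
  · rw [S.reparam_of_mem_vertices _ hx, hvert x hx]
  rw [S.reparam_arc h0 h1 e ht]
  by_cases he : e ∈ S.arcsIn H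
  · exact harc e he t ht
  · rw [hc₂.const e he t ht, hc₁.const e he _ (ArcDecomp.orderIso_mem_Icc (h0 e) (h1 e) ht),
      hvert _ (S.zero_mem e)]

theorem IsForestCollapseWith.unique (hn : 2 ≤ n) {q₁ q₂ : C(G.carrier, G'.carrier)}
    {H₁ K₁ H₂ K₂ : Set G.carrier} (h₁ : IsForestCollapseWith G G' q₁ H₁ K₁)
    (h₂ : IsForestCollapseWith G G' q₂ H₂ K₂) :
    H₁ = H₂ ∧ K₁ = K₂ ∧ ∀ e ∈ edgesIn H₁, q₁ '' e = q₂ '' e := by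
  obtain ⟨E, _, S, hS, h3⟩ := G.isCore.exists_natural_decomp hn
  obtain ⟨E', _, T, -, hT⟩ := G'.isCore.exists_natural_decomp hn
  obtain ⟨hH, hK, hA, l₁, l₂, hl⟩ := h₁.exists_labels hS h3 hT h₂
  refine ⟨hH, hK, ?_⟩
  rw [IsForestCollapseWith.edgesIn_eq hS]
  rintro _ ⟨e, he, rfl⟩
  rw [l₁.image_closedArc he, l₂.image_closedArc (hA ▸ he), (hl e he).1]

theorem IsForestCollapseWith.bijOn (hn : 2 ≤ n) {q : C(G.carrier, G'.carrier)}
    {H K : Set G.carrier} (h : IsForestCollapseWith G G' q H K) :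
    BijOn (fun e : Set G.carrier => q '' e) (edgesIn H) (naturalEdges G'.carrier) := by
  obtain ⟨E, _, S, hS, h3⟩ := G.isCore.exists_natural_decomp hn
  obtain ⟨E', _, T, hTV, hT⟩ := G'.isCore.exists_natural_decomp hn
  have := G'.isCore.connected
  obtain ⟨l⟩ := (h.isArcCollapse hS h3).nonempty_labels h.isHomotopyEquiv h3 T hT
  rw [IsForestCollapseWith.edgesIn_eq hS, T.naturalEdges_eq hTV]
  refine ⟨?_, ?_, ?_⟩
  · rintro _ ⟨e, he, rfl⟩
    exact ⟨l.target e, (l.image_closedArc he).symm⟩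
  · rintro _ ⟨e, he, rfl⟩ _ ⟨e', he', rfl⟩ hee
    simp only [l.image_closedArc he, l.image_closedArc he'] at hee
    rw [l.injOn he he' (T.closedArc_injective hee)]
  · rintro _ ⟨e', rfl⟩
    obtain ⟨e, he, rfl⟩ := l.surjOn (mem_univ e')
    exact ⟨_, ⟨e, he, rfl⟩, l.image_closedArc he⟩

open Classical in
/-- A forest collapse induces a face map. -/
theorem IsForestCollapseWith.exists_isFaceMap (hn : 2 ≤ n) {q : C(G.carrier, G'.carrier)}
    {H K : Set G.carrier} (h : IsForestCollapseWith G G' q H K) :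
    ∃ r : lengthSimplex G'.carrier → lengthSimplex G.carrier, IsFaceMap q H r := by
  have hb := h.bijOn hn
  let φ : naturalEdges G'.carrier → naturalEdges G.carrier := fun e' =>
    ⟨(hb.surjOn e'.2).choose, (hb.surjOn e'.2).choose_spec.1.1⟩
  have hφH : ∀ e', (φ e' : Set G.carrier) ⊆ H := fun e' => (hb.surjOn e'.2).choose_spec.1.2
  have hφq : ∀ e', q '' (φ e' : Set G.carrier) = e' := fun e' => (hb.surjOn e'.2).choose_spec.2
  have hφinj : Function.Injective φ := fun a b hab => by
    apply Subtype.ext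
    rw [← hφq a, ← hφq b, hab]
  have hφe : ∀ (e : naturalEdges G.carrier) (e' : naturalEdges G'.carrier), (e : Set G.carrier) ⊆ H →
      (e' : Set G'.carrier) = q '' (e : Set G.carrier) → φ e' = e := fun e e' heH hee =>
    Subtype.ext (hb.injOn ⟨(φ e').2, hφH e'⟩ ⟨e.2, heH⟩ ((hφq e').trans hee))
  let r : (naturalEdges G'.carrier → ℝ) → naturalEdges G.carrier → ℝ := fun l e =>
    if he : (e : Set G.carrier) ⊆ H then l ⟨q '' (e : Set G.carrier), hb.mapsTo ⟨e.2, he⟩⟩ else 0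
  have hrφ : ∀ l e', r l (φ e') = l e' := fun l e' => by
    simp only [r, dif_pos (hφH e'), hφq]
  have hr0 : ∀ l (e : naturalEdges G.carrier), ¬ (e : Set G.carrier) ⊆ H → r l e = 0 :=
    fun l e he => dif_neg he
  have hsupp : ∀ l, Function.support (r l) ⊆ range φ := by
    intro l e he
    have heH : (e : Set G.carrier) ⊆ H := by
      by_contra hne
      exact he (hr0 l e hne)
    exact ⟨⟨_, hb.mapsTo ⟨e.2, heH⟩⟩, hφe e _ heH rfl⟩
  refine ⟨fun l => ⟨r l.1, fun e => ?_, ?_⟩, fun l e => ⟨fun e' heH hee => ?_, hr0 l.1 e⟩⟩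
  · by_cases he : (e : Set G.carrier) ⊆ H
    · simp only [r, dif_pos he]
      exact l.2.1 _
    · exact (hr0 l.1 e he).ge
  -- The support lies in the range of the injection `φ`, so the sum over all edges becomes the sum
  -- of `l` over the edges of the target.
  · rw [← finsum_mem_univ, ← finsum_mem_inter_support, univ_inter,
      ← inter_eq_right.2 (hsupp l.1), finsum_mem_inter_support, finsum_mem_range hφinj]
    simp only [hrφ]
    exact l.2.2
  · rw [← hφe e e' heH hee]
    exact hrφ l.1 e'

/-- A single collapse already fixes every value, since images of edges in `H` are natural edges. Any
other collapse has the same `H` and the same edge images, so it gives the same formula. -/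
theorem IsForestCollapse.existsUnique_isFaceMap (hn : 2 ≤ n)
    (h : ∃ q : C(G.carrier, G'.carrier), IsForestCollapse G G' q) :
    ∃! r : lengthSimplex G'.carrier → lengthSimplex G.carrier,
      ∀ (q : C(G.carrier, G'.carrier)) (H K : Set G.carrier),
        IsForestCollapseWith G G' q H K → IsFaceMap q H r := by
  obtain ⟨q, H, K, h⟩ := h
  obtain ⟨r, hr⟩ := h.exists_isFaceMap hn
  refine ⟨r, fun q' H' K' h' l e => ?_, fun r' hr' => ?_⟩
  · obtain ⟨rfl, -, heq⟩ := h.unique hn h'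
    refine ⟨fun e' heH hee => ?_, (hr l e).2⟩
    exact (hr l e).1 e' heH (hee.trans (heq e ⟨e.2, heH⟩).symm)
  · have hr' := hr' q H K h
    refine funext fun l => Subtype.ext (funext fun e => ?_)
    by_cases he : (e : Set G.carrier) ⊆ H
    · have hmem := (h.bijOn hn).mapsTo ⟨e.2, he⟩
      rw [(hr' l e).1 ⟨_, hmem⟩ he rfl, (hr l e).1 ⟨_, hmem⟩ he rfl]
    · rw [(hr' l e).2 he, (hr l e).2 he]

end ForestCollapse

theorem mainTheorem11 (n : ℕ) (hn : 2 ≤ n) (G : MarkedGraph.{u} n) (G' : MarkedGraph.{v} n) :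
    (∀ q₁ q₂ : C(G.carrier, G'.carrier), IsForestCollapse G G' q₁ → IsForestCollapse G G' q₂ →
      ∃ h : G.carrier ≃ₜ G.carrier, IsIsotopicToId h ∧ ∀ x, q₂ x = q₁ (h x)) ∧
    (∀ (q₁ q₂ : C(G.carrier, G'.carrier)) (H₁ K₁ H₂ K₂ : Set G.carrier),
      IsForestCollapseWith G G' q₁ H₁ K₁ → IsForestCollapseWith G G' q₂ H₂ K₂ →
        H₁ = H₂ ∧ K₁ = K₂ ∧ ∀ e ∈ edgesIn H₁, q₁ '' e = q₂ '' e) ∧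
    (∀ (q : C(G.carrier, G'.carrier)) (H K : Set G.carrier), IsForestCollapseWith G G' q H K →
      BijOn (fun e : Set G.carrier => q '' e) (edgesIn H) (naturalEdges G'.carrier)) ∧
    ((∃ q : C(G.carrier, G'.carrier), IsForestCollapse G G' q) →
      ∃! r : lengthSimplex G'.carrier → lengthSimplex G.carrier,
        ∀ (q : C(G.carrier, G'.carrier)) (H K : Set G.carrier),
          IsForestCollapseWith G G' q H K → IsFaceMap q H r) :=
  ⟨fun _ _ h₁ h₂ => h₁.exists_isotopic hn h₂, fun _ _ _ _ _ _ h₁ h₂ => h₁.unique hn h₂,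
    fun _ _ _ h => h.bijOn hn, fun h => IsForestCollapse.existsUnique_isFaceMap hn h⟩
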